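/- **Definitions.** For $k\ge 1$ let $\mathrm{OR}_k=\{0,1\}^k\setminus\{0^k\}$ and $\mathrm{NAND}_k=\{0,1\}^k\setminus\{1^k\}$, and let $\Gamma_{\mathrm{pin}}=\{\{0\},\{1\}\}$ consist of the two unary constant relations. For a finite set $\Gamma$ of (named) Boolean relations and $d\ge 1$, $\#\mathrm{CSP}_d(\Gamma)$ is the following problem. The input is a finite set $V$ of variables and a set $C$ of constraints $R(v_1,\dots,v_r)$ with $R\in\Gamma$ of arity $r$ and $v_1,\dots,v_r\in V$ not necessarily distinct, such that every variable appears at most $d$ times in total in the scopes of the constraints in $C$ (counted with multiplicity within a scope). The output is the number of assignments $\sigma:V\to\{0,1\}$ such that $(\sigma(v_1),\dots,\sigma(v_r))\in R$ for every constraint $R(v_1,\dots,v_r)\in C$. The problem $\#w\text{-}\mathrm{HIS}_d$ is the following. The input is a hypergraph $H=(V,E)$, with $V$ finite and $E$ a set of non-empty subsets of $V$, such that $\max\{|e| : e\in E\}=w$ and every vertex is in at most $d$ hyper-edges. The output is the number of independent sets of $H$, that is, of sets $S\subseteq V$ with $e\nsubseteq S$ for every $e\in E$. Instances are encoded as binary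 words in a standard way. A *randomized approximation scheme* (RAS) for a counting problem $f$ takes as input an instance $x$ of $f$ and an error bound $\varepsilon\in(0,1)$, presented as $\varepsilon=1/k$ with an integer $k\ge 2$, and produces a random integer $Y$ with $\Pr(e^{-\varepsilon}f(x)\le Y\le e^{\varepsilon}f(x))\ge \frac34$. An *approximation-preserving* (AP-) reduction from $f$ to $g$ is a probabilistic oracle Turing machine $M$ that takes as input such pairs $(x,\varepsilon)$ and satisfies: (i) every oracle call made by $M$ is of the form $(u,\delta)$ where $u$ is an instance of $g$ and $0<\delta<1$ is an error bound with $\delta^{-1}\le \mathrm{poly}(|x|,\varepsilon^{-1})$; (ii) $M$ is a RAS for $f$ whenever the oracle is a RAS for $g$; (iii) the run-time of $M$ is polynomial in $|x|$ and $\varepsilon^{-1}$. Write $f\equiv_{\mathrm{AP}}g$ ("AP-interreducible") if there are AP-reductions from $f$ to $g$ and from $g$ to $f$. **Lemma.** For all integers $d\ge 2$ and $w\ge 2$, $$\#w\text{-}\mathrm{HIS}_d\;\equiv_{\mathrm{AP}}\;\#\mathrm{CSP}_d(\{\mathrm{OR}_w\}\cup\Gamma_{\mathrm{pin}})\;\equiv_{\mathrm{AP}}\;\#\mathrm{CSP}_d(\{\mathrm{NAND}_w\}\cup\Gamma_{\mathrm{pin}}),$$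 and also $\#w\text{-}\mathrm{HIS}_d\equiv_{\mathrm{AP}}\#\mathrm{CSP}_d(\{\mathrm{NAND}_w\}\cup\Gamma_{\mathrm{pin}})$. -/

import Mathlib

namespace ApproxCount

/-! ### Boolean relations, constraint languages and CSP instances -/

/-- A Boolean relation `R ⊆ {0,1}^r`, together with its arity `r`. -/
structure BoolRel where
  arity : ℕ
  tuples : Finset (Fin arity → Bool)

/-- The `k`-ary relation `OR = {0,1}^k ∖ {0^k}`. -/
def orRel (k : ℕ) : BoolRel := ⟨k, Finset.univ \ {fun _ => false}⟩

/-- The `k`-ary relation `NAND = {0,1}^k ∖ {1^k}`. -/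
def nandRel (k : ℕ) : BoolRel := ⟨k, Finset.univ \ {fun _ => true}⟩

/-- The unary relation `{0}`. -/
def zeroRel : BoolRel := ⟨1, {fun _ => false}⟩

/-- The unary relation `{1}`. -/
def oneRel : BoolRel := ⟨1, {fun _ => true}⟩

/-- A constraint language is a finite set of named relations; the name of a relation is its
position in the list. -/
abbrev ConstraintLanguage := List BoolRel

/-- The language consisting of the two pins. -/
def pins : ConstraintLanguage := [zeroRel, oneRel]

/-- The constraints `R(v₁, …, v_r)` with `R ∈ Γ` and `(v₁, …, v_r) ∈ V^r`; the variables in the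
scope need not be distinct. -/
abbrev Constraint (Γ : ConstraintLanguage) (V : Type) : Type :=
  Σ i : Fin Γ.length, (Fin (Γ.get i).arity → V)

/-- An instance of CSP over `Γ`: a finite set of variables, here `{0, …, n-1}`, and a set of
constraints. -/
structure CSPInstance (Γ : ConstraintLanguage) where
  n : ℕ
  constraints : Finset (Constraint Γ (Fin n))

namespace CSPInstance

variable {Γ : ConstraintLanguage} (I : CSPInstance Γ)

/-- The assignment `a` satisfies the instance. -/
def Satisfies (a : Fin I.n → Bool) : Prop :=
  ∀ c ∈ I.constraints, (fun j => a (c.2 j)) ∈ (Γ.get c.1).tuples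

/-- `Z(I)`, the number of satisfying assignments. -/
noncomputable def numSat : ℕ := Nat.card {a : Fin I.n → Bool // I.Satisfies a}

/-- The number of times that the variable `v` appears in the scopes of the constraints (with
multiplicity within a scope). -/
def occurrences (v : Fin I.n) : ℕ :=
  ∑ c ∈ I.constraints, (Finset.univ.filter fun j => c.2 j = v).card

/-- The greatest number of times that any variable appears. -/
def degree : ℕ := Finset.univ.sup I.occurrences

end CSPInstance

/-! ### Hypergraphs -/

/-- A hypergraph on the vertex set `{0, …, n-1}` with non-empty hyper-edges. -/
structure Hypergraph where
  n : ℕ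
  edges : Finset (Finset (Fin n))
  nonempty : ∀ e ∈ edges, e.Nonempty

namespace Hypergraph

variable (H : Hypergraph)

/-- The maximum over the vertices `v` of the number of hyper-edges that contain `v`. -/
def degree : ℕ := Finset.univ.sup fun v => (H.edges.filter fun e => v ∈ e).card

/-- The maximum size of a hyper-edge. -/
def width : ℕ := H.edges.sup Finset.card

/-- `S` is independent: it contains no hyper-edge as a subset. -/
def Independent (S : Finset (Fin H.n)) : Prop := ∀ e ∈ H.edges, ¬ e ⊆ S

/-- The number of independent sets. -/
noncomputable def numIndep : ℕ := Nat.card {S : Finset (Fin H.n) // H.Independent S}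

end Hypergraph

/-! ### Counting problems on binary words -/

/-- A counting problem: a class of instances, a relation saying which binary words are encodings
of an instance, and the number to be computed. An instance may have several encodings. -/
structure CountingProblem where
  Inst : Type
  Encodes : List Bool → Inst → Prop
  count : Inst → ℕ

/-- The word `1^m 0`. -/
def unary (m : ℕ) : List Bool := List.replicate m true ++ [false]

/-- The code of a constraint: the position of its relation in the language, followed by the
variables in its scope, all in unary. -/
def encodeConstraint {Γ : ConstraintLanguage} {n : ℕ} (c : Constraint Γ (Fin n)) : List Bool :=
  unary c.1 ++ (List.ofFn fun j => unary (c.2 j)).flatten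

/-- A word encodes a CSP instance if it consists of the number of variables in unary, followed by
the codes of the constraints, each listed exactly once, in any order. -/
def CSPInstance.EncodedBy {Γ : ConstraintLanguage} (I : CSPInstance Γ) (x : List Bool) : Prop :=
  ∃ L : List (Constraint Γ (Fin I.n)), L.Nodup ∧ L.toFinset = I.constraints ∧
    x = unary I.n ++ L.flatMap encodeConstraint

/-- A word encodes a hypergraph if it consists of the number of vertices in unary, followed by the
rows of an incidence matrix: the characteristic vectors of the hyper-edges, each listed exactly
once, in any order. -/
def Hypergraph.EncodedBy (H : Hypergraph) (x : List Bool) : Prop :=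
  ∃ L : List (Finset (Fin H.n)), L.Nodup ∧ L.toFinset = H.edges ∧
    x = unary H.n ++ L.flatMap fun e => List.ofFn fun v => decide (v ∈ e)

/-- `#CSP_d(Γ)`: count the satisfying assignments of an instance over `Γ` of degree at
most `d`. -/
noncomputable def countCSP (d : ℕ) (Γ : ConstraintLanguage) : CountingProblem where
  Inst := {I : CSPInstance Γ // I.degree ≤ d}
  Encodes x I := I.1.EncodedBy x
  count I := I.1.numSat

/-- `#w-HIS_d`: count the independent sets of a width-`w` hypergraph of degree at most `d`. -/
noncomputable def countHIS (w d : ℕ) : CountingProblem where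
  Inst := {H : Hypergraph // H.width = w ∧ H.degree ≤ d}
  Encodes x H := H.1.EncodedBy x
  count H := H.1.numIndep

/-! ### Randomized approximation schemes -/

/-- The number with binary expansion `y`, least significant bit first. -/
def binValue (y : List Bool) : ℕ := Nat.ofDigits 2 (y.map Bool.toNat)

/-- A randomized procedure that is given a word `x` and an error bound `ε = 1/k` (through the
number `k`) and returns a random word. -/
abbrev RandProc := List Bool → ℕ → PMF (List Bool)

/-- The procedure is a randomized approximation scheme for `f`: on every encoding of every
instance and for every error bound `ε = 1/k` in `(0,1)` it returns, with probability at least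
`3/4`, an integer `Y` with `e^(-ε) f ≤ Y ≤ e^ε f`. -/
def IsRAS (f : CountingProblem) (A : RandProc) : Prop :=
  ∀ (I : f.Inst) (x : List Bool), f.Encodes x I → ∀ k : ℕ, 2 ≤ k →
    3 / 4 ≤ (A x k).toOuterMeasure
      {y | Real.exp (-(1 / (k : ℝ))) * (f.count I : ℝ) ≤ (binValue y : ℝ) ∧
        (binValue y : ℝ) ≤ Real.exp (1 / (k : ℝ)) * (f.count I : ℝ)}

/-! ### Probabilistic oracle Turing machines -/

/-- A probabilistic oracle Turing machine, in the multi-stack form of Turing machines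
(`Turing.TM2`; a tape is a pair of stacks) with binary stacks. It has two transition functions
`prog false` and `prog true`; every ordinary step uses one of the two, chosen by a fair coin. -/
structure ProbOracleTM where
  /-- The stacks. -/
  K : Type
  [fintypeK : Fintype K]
  [decEqK : DecidableEq K]
  /-- The labels (control states). -/
  Λ : Type
  [fintypeΛ : Fintype Λ]
  [decEqΛ : DecidableEq Λ]
  /-- The values of the finite internal memory. -/
  σ : Type
  [fintypeσ : Fintype σ]
  start : Λ
  memInit : σ
  prog : Bool → Λ → Turing.TM2.Stmt (fun _ : K => Bool) Λ σ
  /-- The label at which the oracle is called. -/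
  ask : Λ
  /-- The label at which the computation continues after a call. -/
  resume : Λ
  /-- The stack that holds the input word. -/
  inStk : K
  /-- The stack that holds the input error bound. -/
  inEpsStk : K
  in_ne : inStk ≠ inEpsStk
  /-- The stack from which the oracle reads a word. -/
  askStk : K
  /-- The stack from which the oracle reads an error bound. -/
  askEpsStk : K
  ask_ne : askStk ≠ askEpsStk
  /-- The stack on which the oracle leaves its answer. -/
  ansStk : K
  /-- The stack that holds the output. -/
  outStk : K

namespace ProbOracleTM

attribute [instance] fintypeK decEqK fintypeΛ decEqΛ fintypeσ

variable (M : ProbOracleTM)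

/-- The configurations: current label (none if the machine has halted), memory and stacks. -/
abbrev Cfg : Type := Turing.TM2.Cfg (fun _ : M.K => Bool) M.Λ M.σ

/-- The initial configuration on input `(x, 1/k)`: the word `x` on the input stack, the word `1^k`
on the error-bound stack, all other stacks empty. -/
def init (x : List Bool) (k : ℕ) : M.Cfg where
  l := some M.start
  var := M.memInit
  stk := Function.update
    (Function.update (fun _ => []) M.inEpsStk (List.replicate k true)) M.inStk x

/-- The distribution of the configuration after one step. At the label `ask` the oracle is called
on the pair `(u, 1/j)`, where `u` is the word on the query stack and `j` is the length of the
word on the error-bound stack of the query, and a fresh sample of its answer replaces the contents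
of the answer stack. Halted configurations do not change. -/
noncomputable def step (O : RandProc) (c : M.Cfg) : PMF M.Cfg :=
  match c.l with
  | none => PMF.pure c
  | some q =>
    if q = M.ask then
      (O (c.stk M.askStk) (c.stk M.askEpsStk).length).map fun a =>
        { l := some M.resume, var := c.var, stk := Function.update c.stk M.ansStk a }
    else
      (PMF.uniformOfFintype Bool).map fun b => Turing.TM2.stepAux (M.prog b q) c.var c.stk

/-- The distribution of the configuration after `t` steps on input `(x, 1/k)` with oracle `O`. -/
noncomputable def run (O : RandProc) (x : List Bool) (k : ℕ) : ℕ → PMF M.Cfg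
  | 0 => PMF.pure (M.init x k)
  | t + 1 => (run O x k t).bind (M.step O)

/-- The distribution of the word on the output stack after `t` steps. -/
noncomputable def output (O : RandProc) (x : List Bool) (k t : ℕ) : PMF (List Bool) :=
  (M.run O x k t).map fun c => c.stk M.outStk

/-- `M` is an approximation-preserving reduction from `f` to `g`, with the polynomial `p` as a
bound. Inputs are `(x, 1/k)` with `x` an encoding of an instance of `f` and `0 < 1/k < 1`.

* `calls`: every oracle call that can occur in a computation, whatever the oracle answers, is of
  the form `(u, 1/j)` with `u` an encoding of an instance of `g`, `0 < 1/j < 1` and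
  `j ≤ p(|x| + k)`.
* `time`: every computation, whatever the coins and the oracle's answers, halts within
  `p(|x| + k)` steps.
* `approx`: `M` is a randomized approximation scheme for `f` whenever the oracle is one
  for `g`. -/
structure IsAPReduction (f g : CountingProblem) (p : Polynomial ℕ) : Prop where
  calls : ∀ (O : RandProc) (I : f.Inst) (x : List Bool), f.Encodes x I → ∀ k : ℕ, 2 ≤ k →
    ∀ t : ℕ, ∀ c ∈ (M.run O x k t).support, c.l = some M.ask →
      (∃ J : g.Inst, g.Encodes (c.stk M.askStk) J) ∧
        2 ≤ (c.stk M.askEpsStk).length ∧ (c.stk M.askEpsStk).length ≤ p.eval (x.length + k)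
  time : ∀ (O : RandProc) (I : f.Inst) (x : List Bool), f.Encodes x I → ∀ k : ℕ, 2 ≤ k →
    ∀ c ∈ (M.run O x k (p.eval (x.length + k))).support, c.l = none
  approx : ∀ O : RandProc, IsRAS g O →
    IsRAS f fun x k => M.output O x k (p.eval (x.length + k))

end ProbOracleTM

/-- `f ≤_AP g`. -/
def APReducible (f g : CountingProblem) : Prop :=
  ∃ (M : ProbOracleTM) (p : Polynomial ℕ), M.IsAPReduction f g p

/-- `f ≡_AP g`. -/
def APInterreducible (f g : CountingProblem) : Prop := APReducible f g ∧ APReducible g f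

end ApproxCount

/-! Every reduction here either preserves the count exactly or discovers that the count is 0. In the
first case one oracle call with the unchanged error bound suffices and its answer is returned
untouched; in the second the empty word, whose value is 0, is a correct output. Hence
`apReducible_of_does` reduces everything to computing a map between instances in polynomial time.

Let `β` be the bit whose constant tuple is missing from the relation (0 for OR, 1 for NAND), and
describe an assignment by the set `S` of variables with value `β`. A constraint then says that its
scope is not contained in `S`, exactly as a hyper-edge does for an independent set. The pin to `β`
says `v ∈ S`; the other pin says `v ∉ S`, which is the hyper-edge `{v}`. So OR and NAND are treated
at once, and passing between them (`apReducible_flip`) only exchanges the two pins.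

From hypergraphs to constraints, a hyper-edge with fewer than `w` vertices is padded to a scope of
length `w` with fresh variables of its own, each pinned to `β`. A fresh variable occurs twice, which
is where `2 ≤ d` enters; being forced into `S`, it has no influence on the count
(`RawHypergraph.rawCSP`, `rawCount_edgeRaws`).

From constraints to hypergraphs, a vertex pinned to `β` is deleted from all scopes and receives the
hyper-edge `{v}`; satisfying sets correspond to independent sets by removing the pinned vertices.
Deletion never raises a degree, and `{v}` is paid for by the occurrence of `v` in its pin. A scope
that becomes empty shows that the count is 0 (`rawCount_eq_zero`). Since the width must be exactly
`w`, a disjoint gadget is added: one hyper-edge on `w` new vertices together with all their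
singletons. It has degree 2 and only the empty independent set (`rawHypergraph_rows`,
`rowCount_rows`).

The maps are written in a small stack language. `Does` is a big-step semantics with a time bound,
`Does.leads` transfers it to compiled stack machines, and `askMachine_behaviour` adds the oracle
call. -/

namespace ApproxCount

/-! ### A small imperative language on binary stacks -/

/-- The stacks used by the programs below. -/
inductive Stk
  | inp | eps | out | z | z2 | r | r2 | o | o2 | a | tmp | bad
  deriving DecidableEq

instance : Fintype Stk where
  elems := {.inp, .eps, .out, .z, .z2, .r, .r2, .o, .o2, .a, .tmp, .bad}
  complete k := by cases k <;> decide

/-- The contents of the stacks. -/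
@[ext] structure Store where
  inp : List Bool := []
  eps : List Bool := []
  out : List Bool := []
  z : List Bool := []
  z2 : List Bool := []
  r : List Bool := []
  r2 : List Bool := []
  o : List Bool := []
  o2 : List Bool := []
  a : List Bool := []
  tmp : List Bool := []
  bad : List Bool := []

namespace Store

/-- The contents of one stack. -/
def get (s : Store) : Stk → List Bool
  | .inp => s.inp | .eps => s.eps | .out => s.out | .z => s.z | .z2 => s.z2 | .r => s.r
  | .r2 => s.r2 | .o => s.o | .o2 => s.o2 | .a => s.a | .tmp => s.tmp | .bad => s.bad

/-- Replace the contents of one stack. -/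
def set (s : Store) (k : Stk) (l : List Bool) : Store :=
  match k with
  | .inp => { s with inp := l } | .eps => { s with eps := l } | .out => { s with out := l }
  | .z => { s with z := l } | .z2 => { s with z2 := l } | .r => { s with r := l }
  | .r2 => { s with r2 := l } | .o => { s with o := l } | .o2 => { s with o2 := l }
  | .a => { s with a := l } | .tmp => { s with tmp := l } | .bad => { s with bad := l }

@[simp] theorem get_set_self (s : Store) (k : Stk) (l : List Bool) : (s.set k l).get k = l := by
  cases k <;> rfl

theorem get_set_of_ne (s : Store) {k k' : Stk} (l : List Bool) (h : k' ≠ k) :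
    (s.set k l).get k' = s.get k' := by
  cases k <;> cases k' <;> first | rfl | exact absurd rfl h

theorem get_set (s : Store) (k : Stk) (l : List Bool) :
    (s.set k l).get = Function.update s.get k l := by
  funext k'
  by_cases h : k' = k
  · subst h; simp
  · simp [get_set_of_ne, h]

theorem ext_get {s s' : Store} (h : ∀ k, s.get k = s'.get k) : s = s' := by
  ext1
  exacts [h .inp, h .eps, h .out, h .z, h .z2, h .r, h .r2, h .o, h .o2, h .a, h .tmp, h .bad]

end Store

/-- Programs. `case` pops a stack and branches on the popped bit (the last branch is taken when
the stack is empty); `loop` pops a stack and runs a body depending on the popped bit, until the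
stack is empty or, if the flag is set, the bit `false` has been popped and treated. -/
inductive Cmd
  | skip
  | push (k : Stk) (b : Bool)
  | seq (c₁ c₂ : Cmd)
  | case (k : Stk) (c : Bool → Cmd) (e : Cmd)
  | loop (k : Stk) (brk : Bool) (c : Bool → Cmd)

/-- Sequential composition of programs. -/
infixr:60 " ;; " => Cmd.seq

/-- `Does c s s' t`: started with the stacks `s`, the program `c` ends with the stacks `s'` after
at most `t` steps. -/
inductive Does : Cmd → Store → Store → ℕ → Prop
  | skip (s) : Does .skip s s 1
  | push (k b s) : Does (.push k b) s (s.set k (b :: s.get k)) 1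
  | seq {c₁ c₂ s s₁ s₂ t₁ t₂} : Does c₁ s s₁ t₁ → Does c₂ s₁ s₂ t₂ →
      Does (.seq c₁ c₂) s s₂ (t₁ + t₂)
  | case_nil {k c e s s' t} : s.get k = [] → Does e s s' t → Does (.case k c e) s s' (t + 1)
  | case_cons {k c e s s' t} {b : Bool} {l : List Bool} : s.get k = b :: l →
      Does (c b) (s.set k l) s' t → Does (.case k c e) s s' (t + 1)
  | loop_nil {k st c s} : s.get k = [] → Does (.loop k st c) s s 1
  | loop_cons {k st c s s₁ s₂ t₁ t₂} {b : Bool} {l : List Bool} : s.get k = b :: l →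
      (st && !b) = false → Does (c b) (s.set k l) s₁ t₁ → Does (.loop k st c) s₁ s₂ t₂ →
      Does (.loop k st c) s s₂ (t₁ + t₂ + 1)
  | loop_exit {k c s s' t} {l : List Bool} : s.get k = false :: l →
      Does (c false) (s.set k l) s' t → Does (.loop k true c) s s' (t + 1)
  | weaken {c s s' t t'} : Does c s s' t → t ≤ t' → Does c s s' t'

theorem Does.of_eq {c : Cmd} {s s' s'' : Store} {t t' : ℕ} (h : Does c s s' t) (hs : s' = s'')
    (ht : t ≤ t') : Does c s s'' t' :=
  hs ▸ h.weaken ht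

/-! ### Compilation to stack machines -/

/-- The labels of the compiled program. -/
def Cmd.Lbl : Cmd → Type
  | .skip => Unit
  | .push _ _ => Unit
  | .seq c₁ c₂ => c₁.Lbl ⊕ c₂.Lbl
  | .case _ c e => Option (e.Lbl ⊕ Σ b, (c b).Lbl)
  | .loop _ _ c => Option (Σ b, (c b).Lbl)

instance Cmd.finite_lbl : (c : Cmd) → Finite c.Lbl
  | .skip => inferInstanceAs (Finite Unit)
  | .push _ _ => inferInstanceAs (Finite Unit)
  | .seq c₁ c₂ =>
    have := c₁.finite_lbl
    have := c₂.finite_lbl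
    inferInstanceAs (Finite (c₁.Lbl ⊕ c₂.Lbl))
  | .case _ c e =>
    have := e.finite_lbl
    have := fun b => (c b).finite_lbl
    inferInstanceAs (Finite (Option (e.Lbl ⊕ Σ b, (c b).Lbl)))
  | .loop _ _ c =>
    have := fun b => (c b).finite_lbl
    inferInstanceAs (Finite (Option (Σ b, (c b).Lbl)))

/-- The label at which a compiled program starts. -/
def Cmd.entry : (c : Cmd) → c.Lbl
  | .skip => ()
  | .push _ _ => ()
  | .seq c₁ _ => Sum.inl c₁.entry
  | .case _ _ _ => none
  | .loop _ _ _ => none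

/-- Statements of the stack machines to which programs are compiled. -/
abbrev MStmt (Λ : Type) : Type := Turing.TM2.Stmt (fun _ : Stk => Bool) Λ (Option Bool)

/-- Configurations of the stack machines to which programs are compiled. -/
abbrev MCfg (Λ : Type) : Type := Turing.TM2.Cfg (fun _ : Stk => Bool) Λ (Option Bool)

/-- The compiled program, with its labels embedded in `Λ` and with `exit` as the label at which
the computation goes on. -/
def Cmd.code {Λ : Type} : (c : Cmd) → (c.Lbl → Λ) → Λ → c.Lbl → MStmt Λ
  | .skip, _, exit, _ => .goto fun _ => exit
  | .push k b, _, exit, _ => .push k (fun _ => b) (.goto fun _ => exit)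
  | .seq c₁ c₂, emb, exit, l =>
    match l with
    | .inl l => c₁.code (fun l => emb (.inl l)) (emb (.inr c₂.entry)) l
    | .inr l => c₂.code (fun l => emb (.inr l)) exit l
  | .case k c e, emb, exit, l =>
    match l with
    | none => .pop k (fun _ o => o) (.goto fun
      | none => emb (some (.inl e.entry))
      | some b => emb (some (.inr ⟨b, (c b).entry⟩)))
    | some (.inl l) => e.code (fun l => emb (some (.inl l))) exit l
    | some (.inr ⟨b, l⟩) => (c b).code (fun l => emb (some (.inr ⟨b, l⟩))) exit l
  | .loop k brk c, emb, exit, l =>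
    match l with
    | none => .pop k (fun _ o => o) (.goto fun
      | none => exit
      | some b => emb (some ⟨b, (c b).entry⟩))
    | some ⟨b, l⟩ =>
      (c b).code (fun l => emb (some ⟨b, l⟩)) (if brk && !b then exit else emb none) l

/-- One step of a deterministic stack machine; halted configurations do not change. -/
def detStep {Λ : Type} (prog : Λ → MStmt Λ) (c : MCfg Λ) : MCfg Λ :=
  match c.l with
  | none => c
  | some q => Turing.TM2.stepAux (prog q) c.var c.stk

/-- The machine passes from `c` to `c'` in at most `T` steps, each from a label in `P`. -/
def Leads {Λ : Type} (prog : Λ → MStmt Λ) (P : Set Λ) (c c' : MCfg Λ) (T : ℕ) : Prop :=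
  ∃ t ≤ T, (detStep prog)^[t] c = c' ∧ ∀ i < t, ∃ q ∈ P, ((detStep prog)^[i] c).l = some q

theorem Leads.trans {Λ : Type} {prog : Λ → MStmt Λ} {P : Set Λ} {c c' c'' : MCfg Λ} {T T' : ℕ}
    (h : Leads prog P c c' T) (h' : Leads prog P c' c'' T') : Leads prog P c c'' (T + T') := by
  obtain ⟨t, ht, hc, hP⟩ := h
  obtain ⟨t', ht', hc', hP'⟩ := h'
  refine ⟨t' + t, by omega, by rw [Function.iterate_add_apply, hc, hc'], fun i hi => ?_⟩
  by_cases hit : i < t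
  · exact hP i hit
  · obtain ⟨j, rfl⟩ := Nat.exists_eq_add_of_le' (Nat.le_of_not_lt hit)
    rw [Function.iterate_add_apply, hc]
    exact hP' j (by omega)

theorem Leads.mono {Λ : Type} {prog : Λ → MStmt Λ} {P Q : Set Λ} {c c' : MCfg Λ} {T T' : ℕ}
    (h : Leads prog P c c' T) (hPQ : P ⊆ Q) (hT : T ≤ T') : Leads prog Q c c' T' := by
  obtain ⟨t, ht, hc, hP⟩ := h
  exact ⟨t, ht.trans hT, hc, fun i hi => (hP i hi).imp fun q hq => ⟨hPQ hq.1, hq.2⟩⟩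

theorem Leads.single {Λ : Type} {prog : Λ → MStmt Λ} {P : Set Λ} {q : Λ} (hq : q ∈ P)
    {v : Option Bool} {s : Stk → List Bool} {c' : MCfg Λ}
    (h : Turing.TM2.stepAux (prog q) v s = c') : Leads prog P ⟨some q, v, s⟩ c' 1 := by
  refine ⟨1, le_rfl, h, fun i hi => ?_⟩
  obtain rfl : i = 0 := by omega
  exact ⟨q, hq, rfl⟩

/-- Correctness of compilation, by induction on the derivation. The code of a subprogram is the same
for every embedding of its labels, so the induction hypothesis applies with the embedding and the
exit label chosen by the surrounding program: the first half of a sequence exits to the entry of the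
second, a loop body to the head of the loop or, on a break, to the exit. The memory only holds the
last popped bit and is never read later, so its final value is left existential. Recording that all
labels lie in the range of `emb` shows that no oracle call intervenes. -/
theorem Does.leads {c : Cmd} {s s' : Store} {t : ℕ} (h : Does c s s' t) :
    ∀ {Λ : Type} (prog : Λ → MStmt Λ) (emb : c.Lbl → Λ) (exit : Λ),
      (∀ l, prog (emb l) = c.code emb exit l) → ∀ v : Option Bool, ∃ v' : Option Bool,
        Leads prog (Set.range emb) ⟨some (emb c.entry), v, s.get⟩ ⟨some exit, v', s'.get⟩ t := by
  induction h with
  | skip s =>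
    intro Λ prog emb exit hp v
    exact ⟨v, .single (Set.mem_range_self _) (by rw [hp]; rfl)⟩
  | push k b s =>
    intro Λ prog emb exit hp v
    exact ⟨v, .single (Set.mem_range_self _) (by rw [hp, Store.get_set]; rfl)⟩
  | @seq c₁ c₂ s s₁ s₂ t₁ t₂ _ _ ih₁ ih₂ =>
    intro Λ prog emb exit hp v
    obtain ⟨v₁, h₁⟩ := ih₁ prog (fun l => emb (.inl l)) (emb (.inr c₂.entry))
      (fun l => hp (.inl l)) v
    obtain ⟨v₂, h₂⟩ := ih₂ prog (fun l => emb (.inr l)) exit (fun l => hp (.inr l)) v₁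
    refine ⟨v₂, (h₁.mono ?_ le_rfl).trans (h₂.mono ?_ le_rfl)⟩
    · rintro _ ⟨l, rfl⟩; exact ⟨_, rfl⟩
    · rintro _ ⟨l, rfl⟩; exact ⟨_, rfl⟩
  | @case_nil k c e s s' t hk _ ih =>
    intro Λ prog emb exit hp v
    obtain ⟨v', h'⟩ := ih prog (fun l => emb (some (.inl l))) exit
      (fun l => hp (some (.inl l))) none
    have h1 : Leads prog (Set.range emb) ⟨some (emb (Cmd.case k c e).entry), v, s.get⟩
        ⟨some (emb (some (.inl e.entry))), none, s.get⟩ 1 := by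
      refine .single (Set.mem_range_self _) ?_
      rw [hp]
      simp only [Cmd.entry, Cmd.code, Turing.TM2.stepAux, hk, List.head?_nil, List.tail_nil]
      -- Popping an empty stack writes back the tail of the empty list, so no stack changes.
      rw [← hk, Function.update_eq_self]
    refine ⟨v', (h1.trans (h'.mono ?_ le_rfl)).mono subset_rfl (by omega)⟩
    rintro _ ⟨l, rfl⟩; exact ⟨_, rfl⟩
  | @case_cons k c e s s' t b l hk _ ih =>
    intro Λ prog emb exit hp v
    obtain ⟨v', h'⟩ := ih prog (fun l => emb (some (.inr ⟨b, l⟩))) exit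
      (fun l => hp (some (.inr ⟨b, l⟩))) (some b)
    have h1 : Leads prog (Set.range emb) ⟨some (emb (Cmd.case k c e).entry), v, s.get⟩
        ⟨some (emb (some (.inr ⟨b, (c b).entry⟩))), some b, (s.set k l).get⟩ 1 := by
      refine .single (Set.mem_range_self _) ?_
      rw [hp]
      simp [Cmd.entry, Cmd.code, hk, Store.get_set]
    refine ⟨v', (h1.trans (h'.mono ?_ le_rfl)).mono subset_rfl (by omega)⟩
    rintro _ ⟨l, rfl⟩; exact ⟨_, rfl⟩
  | @loop_nil k st c s hk =>
    intro Λ prog emb exit hp v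
    refine ⟨none, .single (Set.mem_range_self _) ?_⟩
    rw [hp]
    simp only [Cmd.entry, Cmd.code, Turing.TM2.stepAux, hk, List.head?_nil, List.tail_nil]
    rw [← hk, Function.update_eq_self]
  | @loop_cons k st c s s₁ s₂ t₁ t₂ b l hk hst _ _ ih₁ ih₂ =>
    intro Λ prog emb exit hp v
    obtain ⟨v₁, h₁⟩ := ih₁ prog (fun l => emb (some ⟨b, l⟩)) (emb none)
      (fun l => by rw [hp (some ⟨b, l⟩)]; simp [Cmd.code, hst]) (some b)
    obtain ⟨v₂, h₂⟩ := ih₂ prog emb exit hp v₁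
    have h0 : Leads prog (Set.range emb) ⟨some (emb (Cmd.loop k st c).entry), v, s.get⟩
        ⟨some (emb (some ⟨b, (c b).entry⟩)), some b, (s.set k l).get⟩ 1 := by
      refine .single (Set.mem_range_self _) ?_
      rw [hp]
      simp [Cmd.entry, Cmd.code, hk, Store.get_set]
    refine ⟨v₂, ((h0.trans (h₁.mono ?_ le_rfl)).trans h₂).mono subset_rfl (by omega)⟩
    rintro _ ⟨l, rfl⟩; exact ⟨_, rfl⟩
  | @loop_exit k c s s' t l hk _ ih =>
    intro Λ prog emb exit hp v
    obtain ⟨v₁, h₁⟩ := ih prog (fun l => emb (some ⟨false, l⟩)) exit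
      (fun l => by rw [hp (some ⟨false, l⟩)]; simp [Cmd.code]) (some false)
    have h0 : Leads prog (Set.range emb) ⟨some (emb (Cmd.loop k true c).entry), v, s.get⟩
        ⟨some (emb (some ⟨false, (c false).entry⟩)), some false, (s.set k l).get⟩ 1 := by
      refine .single (Set.mem_range_self _) ?_
      rw [hp]
      simp [Cmd.entry, Cmd.code, hk, Store.get_set]
    refine ⟨v₁, (h0.trans (h₁.mono ?_ le_rfl)).mono subset_rfl (by omega)⟩
    rintro _ ⟨l, rfl⟩; exact ⟨_, rfl⟩
  | weaken _ ht ih =>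
    intro Λ prog emb exit hp v
    obtain ⟨v', h'⟩ := ih prog emb exit hp v
    exact ⟨v', h'.mono subset_rfl ht⟩

/-! ### From programs to reductions -/

/-- The labels of the machine that runs the program `c` and then asks the oracle. -/
inductive AskLbl (c : Cmd)
  | main (l : c.Lbl)
  | check
  | ask
  | resume

theorem AskLbl.finite (c : Cmd) : Finite (AskLbl c) :=
  Finite.of_surjective
    (fun x : Option (Option (Option c.Lbl)) => match x with
      | none => AskLbl.check
      | some none => .ask
      | some (some none) => .resume
      | some (some (some l)) => .main l)
    (by
      rintro (l | _ | _ | _)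
      exacts [⟨some (some (some l)), rfl⟩, ⟨none, rfl⟩, ⟨some none, rfl⟩, ⟨some (some none), rfl⟩])

/-- The transition function of the machine that runs the program `c` and then either halts, if
the stack `bad` is non-empty, or asks the oracle. -/
def askProg (c : Cmd) : AskLbl c → MStmt (AskLbl c)
  | .main l => c.code .main .check l
  | .check => .pop .bad (fun _ o => o) (.branch (fun o => o.isSome) .halt (.goto fun _ => .ask))
  | .ask => .halt
  | .resume => .halt

open Classical in
/-- The oracle machine that runs the program `c`, asks the oracle at most once, about the word on
the stack `out`, and returns its answer. -/
noncomputable abbrev askMachine (c : Cmd) : ProbOracleTM where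
  K := Stk
  Λ := AskLbl c
  fintypeΛ := @Fintype.ofFinite _ (AskLbl.finite c)
  σ := Option Bool
  start := .main c.entry
  memInit := none
  prog _ := askProg c
  ask := .ask
  resume := .resume
  inStk := .inp
  inEpsStk := .eps
  in_ne := by decide
  askStk := .out
  askEpsStk := .eps
  ask_ne := by decide
  ansStk := .inp
  outStk := .inp

/-- The initial stacks on input `(x, 1/k)`. -/
def initStore (x : List Bool) (k : ℕ) : Store where
  inp := x
  eps := List.replicate k true

theorem askMachine_init (c : Cmd) (x : List Bool) (k : ℕ) :
    (askMachine c).init x k = (⟨some (.main c.entry), none, (initStore x k).get⟩ : MCfg _) := by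
  unfold ProbOracleTM.init
  congr 1
  funext i
  cases i <;> rfl

/-- Both transition functions of the machine agree, so the fair coin has no effect and the step is
deterministic away from the oracle. -/
theorem askMachine_step {c : Cmd} (O : RandProc) {q : AskLbl c} (hq : q ≠ .ask) (v : Option Bool)
    (S : Stk → List Bool) :
    (askMachine c).step O (⟨some q, v, S⟩ : MCfg _) =
      PMF.pure (detStep (askProg c) ⟨some q, v, S⟩) := by
  unfold ProbOracleTM.step
  simp only
  rw [if_neg (show ¬ q = (askMachine c).ask from hq)]
  exact PMF.map_const _ _

theorem askMachine_run {c : Cmd} (O : RandProc) (x : List Bool) (k T : ℕ)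
    (h : ∀ i < T, ∃ q, q ≠ AskLbl.ask ∧
      ((detStep (askProg c))^[i] ⟨some (.main c.entry), none, (initStore x k).get⟩).l = some q) :
    (askMachine c).run O x k T =
      PMF.pure ((detStep (askProg c))^[T] ⟨some (.main c.entry), none, (initStore x k).get⟩) := by
  induction T with
  | zero => simp only [ProbOracleTM.run, askMachine_init]; rfl
  | succ T ih =>
    obtain ⟨q, hq, hl⟩ := h T (by omega)
    rw [ProbOracleTM.run, ih fun i hi => h i (by omega), PMF.pure_bind,
      Function.iterate_succ_apply']
    generalize (detStep (askProg c))^[T] _ = cfg at hl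
    obtain ⟨l, v, S⟩ := cfg
    simp only at hl
    subst hl
    exact askMachine_step O hq v S

/-- Halted configurations are fixed by a step. A configuration that is not halted has weight zero at
time `t` and does not contribute to the sum. -/
theorem run_of_halted (M : ProbOracleTM) (O : RandProc) (x : List Bool) (k t u : ℕ)
    (h : ∀ c ∈ (M.run O x k t).support, c.l = none) : M.run O x k (t + u) = M.run O x k t := by
  induction u with
  | zero => rfl
  | succ u ih =>
    rw [← Nat.add_assoc, ProbOracleTM.run, ih]
    conv_rhs => rw [← PMF.bind_pure (M.run O x k t)]
    ext c
    simp only [PMF.bind_apply]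
    refine tsum_congr fun c' => ?_
    by_cases hc : c' ∈ (M.run O x k t).support
    · have : M.step O c' = PMF.pure c' := by
        unfold ProbOracleTM.step
        rw [h c' hc]
      rw [this]
    · rw [PMF.mem_support_iff, not_not] at hc
      simp [hc]

/-- How the machine of a program behaves: it either halts with an empty output, or asks the
oracle once and returns its answer. -/
theorem askMachine_behaviour {c : Cmd} {x : List Bool} {k T : ℕ} {s : Store}
    (hc : Does c (initStore x k) s T) (hinp : s.inp = []) (O : RandProc) :
    ∃ t₀ ≤ T + 3,
      (∀ cfg ∈ ((askMachine c).run O x k t₀).support, cfg.l = none) ∧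
      (∀ t, ∀ cfg ∈ ((askMachine c).run O x k t).support, cfg.l = some AskLbl.ask →
        s.bad = [] ∧ cfg.stk = s.get) ∧
      (askMachine c).output O x k t₀ =
        if s.bad = [] then O s.out s.eps.length else PMF.pure [] := by
  obtain ⟨v, t, ht, hs, hlab⟩ := hc.leads (askProg c) AskLbl.main .check (fun l => rfl) none
  -- Up to and including the visit of `check` at time `t`, no label is `ask`; hence the run is a
  -- point mass through time `t + 1`.
  have hpre : ∀ i < t + 1, ∃ q, q ≠ AskLbl.ask ∧
      ((detStep (askProg c))^[i] ⟨some (.main c.entry), none, (initStore x k).get⟩).l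
        = some q := by
    intro i hi
    rcases Nat.lt_succ_iff_lt_or_eq.1 hi with hi | rfl
    · obtain ⟨_, ⟨l, rfl⟩, hl⟩ := hlab i hi
      exact ⟨.main l, by simp, hl⟩
    · exact ⟨.check, by simp, by rw [hs]⟩
  have hrun := fun i (hi : i ≤ t + 1) =>
    askMachine_run O x k i fun j hj => hpre j (by omega)
  have hpreask : ∀ i < t + 1, ∀ cfg ∈ ((askMachine c).run O x k i).support,
      cfg.l ≠ some AskLbl.ask := by
    intro i hi cfg hcfg
    rw [hrun i hi.le, PMF.support_pure, Set.mem_singleton_iff] at hcfg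
    obtain ⟨q, hq, hl⟩ := hpre i hi
    subst hcfg
    rw [hl]
    simpa using hq
  have hnext := hrun (t + 1) le_rfl
  rw [Function.iterate_succ_apply', hs] at hnext
  by_cases hb : s.bad = []
  -- With `bad` empty the machine is at `ask` at time `t + 1`, at `resume` at time `t + 2`, and
  -- halted at time `t + 3`.
  · have hask : detStep (askProg c) ⟨some .check, v, s.get⟩ = ⟨some .ask, none, s.get⟩ := by
      simp only [detStep, askProg, Turing.TM2.stepAux]
      have : s.get .bad = [] := hb
      simp only [this, List.head?_nil, Option.isSome_none, cond_false, List.tail_nil]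
      rw [← this, Function.update_eq_self]
    rw [hask] at hnext
    have hrun2 : (askMachine c).run O x k (t + 2) =
        (O s.out s.eps.length).map fun a =>
          (⟨some .resume, none, Function.update s.get Stk.inp a⟩ : MCfg (AskLbl c)) := by
      rw [ProbOracleTM.run, hnext, PMF.pure_bind]
      unfold ProbOracleTM.step
      simp only
      rw [if_pos trivial]
      rfl
    have hrun3 : (askMachine c).run O x k (t + 3) =
        (O s.out s.eps.length).map fun a =>
          (⟨none, none, Function.update s.get Stk.inp a⟩ : MCfg (AskLbl c)) := by
      rw [ProbOracleTM.run, hrun2, PMF.bind_map]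
      refine congrArg _ (funext fun a => ?_)
      exact askMachine_step O (by simp) _ _
    have hhalt : ∀ cfg ∈ ((askMachine c).run O x k (t + 3)).support, cfg.l = none := by
      intro cfg hcfg
      rw [hrun3, PMF.support_map] at hcfg
      obtain ⟨a, _, rfl⟩ := hcfg
      rfl
    refine ⟨t + 3, by omega, hhalt, ?_, ?_⟩
    · intro i cfg hcfg hl
      refine ⟨hb, ?_⟩
      rcases lt_trichotomy i (t + 1) with hi | rfl | hi
      · exact absurd hl (hpreask i hi cfg hcfg)
      · rw [hnext, PMF.support_pure, Set.mem_singleton_iff] at hcfg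
        rw [hcfg]
      · rcases Nat.lt_succ_iff_lt_or_eq.1 (Nat.succ_lt_succ hi) with hi | hi
        · obtain ⟨j, rfl⟩ | rfl : (∃ j, i = t + 3 + j) ∨ i = t + 2 := by
            by_cases h : i = t + 2
            · exact .inr h
            · exact .inl ⟨i - (t + 3), by omega⟩
          · rw [run_of_halted _ _ _ _ _ _ hhalt] at hcfg
            rw [hhalt cfg hcfg] at hl
            cases hl
          · rw [hrun2, PMF.support_map] at hcfg
            obtain ⟨a, _, rfl⟩ := hcfg
            simp at hl
        · obtain rfl : i = t + 2 := by omega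
          rw [hrun2, PMF.support_map] at hcfg
          obtain ⟨a, _, rfl⟩ := hcfg
          simp at hl
    -- The oracle's answer replaces the contents of `inp`, which is also the output stack, so the
    -- output has the distribution of the answer.
    · rw [if_pos hb, ProbOracleTM.output, hrun3, PMF.map_comp]
      convert PMF.map_id _ using 2
      funext a
      exact (Function.update_self Stk.inp a s.get).symm ▸ rfl
  · have hh : detStep (askProg c) ⟨some .check, v, s.get⟩ =
        ⟨none, s.bad.head?, (s.set .bad s.bad.tail).get⟩ := by
      rw [Store.get_set]
      obtain ⟨b, l, hbl⟩ := List.exists_cons_of_ne_nil hb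
      have : s.get .bad = b :: l := hbl
      simp [detStep, askProg, Turing.TM2.stepAux, this, hbl]
    rw [hh] at hnext
    have hhalt : ∀ cfg ∈ ((askMachine c).run O x k (t + 1)).support, cfg.l = none := by
      intro cfg hcfg
      rw [hnext, PMF.support_pure, Set.mem_singleton_iff] at hcfg
      rw [hcfg]
    refine ⟨t + 1, by omega, hhalt, ?_, ?_⟩
    · intro i cfg hcfg hl
      rcases lt_or_ge i (t + 1) with hi | hi
      · exact absurd hl (hpreask i hi cfg hcfg)
      · obtain ⟨j, rfl⟩ := Nat.exists_eq_add_of_le hi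
        rw [run_of_halted _ _ _ _ _ _ hhalt] at hcfg
        rw [hhalt cfg hcfg] at hl
        cases hl
    · rw [if_neg hb, ProbOracleTM.output, hnext, PMF.pure_map]
      exact congrArg PMF.pure hinp

/-- A program that computes, in cubic time, an instance of `g` with the same count as the given
instance of `f`, or detects that the count is `0`, yields an AP-reduction. -/
theorem apReducible_of_does {f g : CountingProblem} (c : Cmd) (a b : ℕ)
    (h : ∀ (I : f.Inst) (x : List Bool), f.Encodes x I → ∀ k : ℕ, ∃ s : Store,
      Does c (initStore x k) s (a * (x.length + b) ^ 3) ∧ s.inp = [] ∧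
      ((s.bad ≠ [] ∧ f.count I = 0) ∨
        (s.bad = [] ∧ s.eps.length = k ∧ ∃ J, g.Encodes s.out J ∧ g.count J = f.count I))) :
    APReducible f g := by
  -- The cubic term pays for the program, the constant 3 for the steps after it, and the linear term
  -- bounds the query's error parameter, which is the input `k` itself.
  set p : Polynomial ℕ := Polynomial.C a * (Polynomial.X + Polynomial.C b) ^ 3 +
    Polynomial.X + Polynomial.C 3 with hp
  have hpe : ∀ m n : ℕ, a * (m + b) ^ 3 + 3 ≤ p.eval (m + n) ∧ n ≤ p.eval (m + n) := by
    intro m n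
    have h1 : p.eval (m + n) = a * (m + n + b) ^ 3 + (m + n) + 3 := by
      simp [hp]
    have h2 : a * (m + b) ^ 3 ≤ a * (m + n + b) ^ 3 := by gcongr; omega
    omega
  refine ⟨askMachine c, p, ?_, ?_, ?_⟩
  · intro O I x hx k hk t cfg hcfg hl
    obtain ⟨s, hs, hinp, hres⟩ := h I x hx k
    obtain ⟨t₀, ht₀, -, hask, -⟩ := askMachine_behaviour hs hinp O
    obtain ⟨hb, hstk⟩ := hask t cfg hcfg hl
    rcases hres with ⟨hb', -⟩ | ⟨-, hk', J, hJ, -⟩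
    · exact absurd hb hb'
    · have e1 : cfg.stk (askMachine c).askStk = s.out := by rw [hstk]; rfl
      have e2 : cfg.stk (askMachine c).askEpsStk = s.eps := by rw [hstk]; rfl
      rw [e1, e2, hk']
      exact ⟨⟨J, hJ⟩, hk, (hpe _ _).2⟩
  · intro O I x hx k hk cfg hcfg
    obtain ⟨s, hs, hinp, -⟩ := h I x hx k
    obtain ⟨t₀, ht₀, hhalt, -, -⟩ := askMachine_behaviour hs hinp O
    obtain ⟨u, hu⟩ := Nat.exists_eq_add_of_le (ht₀.trans (hpe x.length k).1)
    rw [hu, run_of_halted _ _ _ _ _ _ hhalt] at hcfg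
    exact hhalt cfg hcfg
  · intro O hO I x hx k hk
    obtain ⟨s, hs, hinp, hres⟩ := h I x hx k
    obtain ⟨t₀, ht₀, hhalt, -, hout⟩ := askMachine_behaviour hs hinp O
    obtain ⟨u, hu⟩ := Nat.exists_eq_add_of_le (ht₀.trans (hpe x.length k).1)
    have hout' : (askMachine c).output O x k (p.eval (x.length + k)) =
        if s.bad = [] then O s.out s.eps.length else PMF.pure [] := by
      rw [← hout, ProbOracleTM.output, ProbOracleTM.output, hu,
        run_of_halted _ _ _ _ _ _ hhalt]
    simp only [hout']
    rcases hres with ⟨hb, h0⟩ | ⟨hb, hk', J, hJ, hcount⟩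
    -- The empty output has value 0, which is the exact count, so the success probability is 1.
    · rw [if_neg hb, h0, PMF.toOuterMeasure_pure_apply, if_pos (by simp [binValue])]
      exact ENNReal.div_le_of_le_mul (by norm_num)
    · rw [if_pos hb, hk', ← hcount]
      exact hO J s.out hJ k hk

/-! ### Basic programs -/

namespace Store

theorem get_set_apply (s : Store) (k k' : Stk) (l : List Bool) :
    (s.set k l).get k' = if k' = k then l else s.get k' := by
  rw [get_set, Function.update_apply]

theorem set_eq_self {s : Store} {k : Stk} {l : List Bool} (h : s.get k = l) : s.set k l = s :=
  ext_get fun k' => by rw [get_set_apply]; split_ifs with h' <;> simp_all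

@[simp] theorem set_set (s : Store) (k : Stk) (l l' : List Bool) :
    (s.set k l).set k l' = s.set k l' :=
  ext_get fun k' => by simp only [get_set_apply]; split_ifs <;> rfl

end Store

namespace Cmd

/-- Run a program `n` times. -/
def rep : ℕ → Cmd → Cmd
  | 0, _ => skip
  | n + 1, c => c ;; rep n c

/-- Push the bits of a word, one after the other. -/
def pushList (k : Stk) : List Bool → Cmd
  | [] => skip
  | b :: l => push k b ;; pushList k l

/-- Empty a stack. -/
def clear (k : Stk) : Cmd := loop k false fun _ => skip

/-- Pour one stack onto another. -/
def move (k k' : Stk) : Cmd := loop k false fun b => push k' b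

/-- Run a program as long as a stack is non-empty. -/
def whileNonempty (k : Stk) (c : Cmd) : Cmd := loop k false fun b => push k b ;; c

/-- Read a number in unary and run a program as many times. -/
def readUnary (c : Cmd) : Cmd := loop .inp true fun b => cond b c skip

/-- Push a row of zeros, of the length of the stack `z`. -/
def fill (k : Stk) : Cmd := loop .z false (fun b => push .z2 b ;; push k false) ;; move .z2 .z

end Cmd

open Cmd

theorem does_pushList (k : Stk) (l : List Bool) (s : Store) :
    Does (pushList k l) s (s.set k (l.reverse ++ s.get k)) (l.length + 1) := by
  induction l generalizing s with
  | nil => exact Does.of_eq (Does.skip s) (Store.set_eq_self rfl).symm (by simp)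
  | cons b l ih =>
    exact Does.of_eq ((Does.push k b s).seq (ih _)) (by simp) (by simp; omega)

theorem does_clear (k : Stk) (l : List Bool) (s : Store) (h : s.get k = l) :
    Does (clear k) s (s.set k []) (2 * l.length + 1) := by
  induction l generalizing s with
  | nil => exact Does.of_eq (Does.loop_nil h) (Store.set_eq_self h).symm (by simp)
  | cons b l ih =>
    exact Does.of_eq (Does.loop_cons h rfl (.skip _) (ih _ (by simp))) (by simp) (by simp; omega)

theorem does_move {k k' : Stk} (hk : k ≠ k') (l : List Bool) (s : Store) (h : s.get k = l) :
    Does (move k k') s ((s.set k []).set k' (l.reverse ++ s.get k')) (2 * l.length + 1) := by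
  induction l generalizing s with
  | nil =>
    refine Does.of_eq (Does.loop_nil h) ?_ (by simp)
    rw [Store.set_eq_self h, Store.set_eq_self (by simp)]
  | cons b l ih =>
    refine Does.of_eq (Does.loop_cons h rfl (.push _ _ _) (ih _ ?_)) ?_ (by simp; omega)
    · simp [Store.get_set_apply, hk]
    · refine Store.ext_get fun j => ?_
      simp only [Store.get_set_apply]
      split_ifs <;> simp_all

theorem does_while {k : Stk} {c : Cmd} {s s₁ s₂ : Store} {t₁ t₂ : ℕ} (h : s.get k ≠ [])
    (h₁ : Does c s s₁ t₁) (h₂ : Does (whileNonempty k c) s₁ s₂ t₂) :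
    Does (whileNonempty k c) s s₂ (t₁ + t₂ + 2) := by
  obtain ⟨b, l, hbl⟩ := List.exists_cons_of_ne_nil h
  -- The two additional steps pop a bit to test the stack and push it back.
  refine Does.weaken (Does.loop_cons hbl rfl (.seq (.push k b _) ?_) h₂) (t := 1 + t₁ + t₂ + 1)
    (by omega)
  rwa [Store.set_set, Store.get_set_self, Store.set_eq_self hbl]

/-- Pouring `z` onto `z2` counts off the zeros; pouring it back restores `z`. This is how a stack
serves as a reusable length. -/
theorem does_fill {k : Stk} (hk : k = .a ∨ k = .o ∨ k = .r) (s : Store) (hz : s.z2 = []) :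
    Does (fill k) s (s.set k (List.replicate s.z.length false ++ s.get k))
      (5 * s.z.length + 2) := by
  have key : ∀ (l : List Bool) (s : Store), s.z = l →
      Does (loop .z false (fun b => push .z2 b ;; push k false)) s
        (({ s with z := [], z2 := l.reverse ++ s.z2 } : Store).set k
          (List.replicate l.length false ++ s.get k)) (3 * l.length + 1) := by
    intro l
    induction l with
    | nil =>
      intro s h
      refine Does.of_eq (Does.loop_nil h) ?_ (by simp)
      rcases hk with rfl | rfl | rfl <;> ext1 <;> simp [Store.set, Store.get, h]
    | cons b l ih =>
      intro s h
      refine Does.of_eq (Does.loop_cons h rfl (.seq (.push _ _ _) (.push _ _ _)) (ih _ ?_)) ?_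
        (by simp; omega)
      · rcases hk with rfl | rfl | rfl <;> rfl
      · rcases hk with rfl | rfl | rfl <;>
          simp [Store.set, Store.get, List.replicate_succ', List.append_assoc]
  refine Does.of_eq ((key _ s rfl).seq (does_move (by decide) s.z.reverse _ ?_)) ?_
    (by simp; omega)
  · rcases hk with rfl | rfl | rfl <;> simp [Store.set, Store.get, hz]
  · rcases hk with rfl | rfl | rfl <;> simp [Store.set, Store.get, hz]

theorem unary_append (v : ℕ) (rest : List Bool) :
    unary v ++ rest = List.replicate v true ++ false :: rest := by
  simp [unary]

theorem does_readUnary_push {k : Stk} (hk : k ≠ .inp) (rest : List Bool) (v : ℕ) (s : Store)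
    (h : s.inp = unary v ++ rest) :
    Does (readUnary (push k true)) s
      ((s.set .inp rest).set k (List.replicate v true ++ s.get k)) (2 * v + 2) := by
  rw [unary_append] at h
  induction v generalizing s with
  | zero =>
    refine Does.of_eq (Does.loop_exit h (.skip _)) ?_ (by simp)
    refine Store.ext_get fun j => ?_
    simp only [Store.get_set_apply]
    split_ifs <;> simp_all
  | succ v ih =>
    refine Does.of_eq (Does.loop_cons (b := true) h rfl (.push _ _ _) (ih _ ?_)) ?_ (by omega)
    · rw [← Store.get, Store.get_set_of_ne _ _ hk.symm]; rfl
    · refine Store.ext_get fun j => ?_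
      simp only [Store.get_set_apply]
      split_ifs <;> simp_all [List.replicate_succ']

/-! ### Reading constraints -/

/-- The code of a constraint given by the position of its relation and by its scope. -/
def rawCode (c : ℕ × List ℕ) : List Bool := unary c.1 ++ c.2.flatMap unary

/-- Read constraints over a language with three relations, and treat each by a program that
depends on the position of its relation. -/
def dispatch (c : ℕ → Cmd) : Cmd :=
  loop .inp false fun b => cond b
    (case .inp (fun b' => cond b' (case .inp (fun _ => c 2) skip) (c 1)) skip) (c 0)

theorem does_dispatch_nil (c : ℕ → Cmd) (s : Store) (h : s.inp = []) :
    Does (dispatch c) s s 1 := .loop_nil h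

theorem does_dispatch_cons {c : ℕ → Cmd} {c' : Cmd} {s s₁ s₂ : Store} {t₁ t₂ i : ℕ} {l : List ℕ}
    {rest : List Bool} (h : s.inp = rawCode (i, l) ++ rest) (hi : i < 3)
    (hc : c i = c') (h₁ : Does c' { s with inp := l.flatMap unary ++ rest } s₁ t₁)
    (h₂ : Does (dispatch c) s₁ s₂ t₂) : Does (dispatch c) s s₂ (t₁ + t₂ + 3) := by
  subst hc
  rw [rawCode, List.append_assoc, unary_append] at h
  simp only at h
  -- The positions 0, 1, 2 are coded as `0`, `10`, `110`, so the loop and the two nested cases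
  -- consume exactly one code.
  interval_cases i
  · exact Does.weaken (Does.loop_cons (b := false) h rfl h₁ h₂) (by omega)
  · exact Does.weaken (Does.loop_cons (b := true) h rfl
      (.case_cons (b := false) (s := s.set .inp _) rfl h₁) h₂) (by omega)
  · exact Does.weaken (Does.loop_cons (b := true) h rfl
      (.case_cons (b := true) (s := s.set .inp _) rfl
        (.case_cons (b := false) (s := (s.set .inp _).set .inp _) rfl h₁)) h₂)
      (by omega)

/-! ### Operations on rows -/

namespace Cmd

/-- Set the bit of the row `r` whose position is read in unary. -/
def setBit : Cmd :=
  readUnary (case .r (fun b => push .r2 b) skip) ;;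
    case .r (fun _ => push .r true) skip ;; move .r2 .r

/-- Replace the rows `r` and `o` by bitwise functions of them. -/
def zip (f g : Bool → Bool → Bool) : Cmd :=
  loop .r false (fun x => case .o (fun y => push .r2 (f x y) ;; push .o2 (g x y)) skip) ;;
    move .r2 .r ;; move .o2 .o

/-- Raise the flag `bad` if the row `r` has no true bit. -/
def test : Cmd :=
  loop .r false (fun b => push .r2 b ;; cond b (push .z2 true) skip) ;;
    case .z2 (fun _ => clear .z2) (push .bad true) ;; move .r2 .r

/-- Move a row from `out` to `tmp` and push a bit on `z2` if it equals the row `r`. -/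
def cmpRow : Cmd :=
  loop .r false (fun x => push .r2 x ;;
    case .out (fun y => push .tmp y ;; cond (x ^^ y) (push .o2 true) skip) skip) ;;
    move .r2 .r ;; case .o2 (fun _ => clear .o2) (push .z2 true)

/-- Insert the row `r` into the list of rows `out`, unless it is there already. -/
def insertRow : Cmd :=
  whileNonempty .out cmpRow ;; move .tmp .out ;;
    case .z2 (fun _ => clear .z2 ;; clear .r) (move .r .r2 ;; move .r2 .out)

end Cmd

/-- Each 1 of the unary number moves one bit of `r` onto `r2`; the bit then on top is the one to
overwrite, and `r2` is poured back. -/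
theorem does_setBit {v : ℕ} {rest : List Bool} {s : Store} (h : s.inp = unary v ++ rest)
    (hv : v < s.r.length) (hr : s.r2 = []) :
    Does setBit s { s with inp := rest, r := s.r.set v true } (5 * s.r.length + 5) := by
  have key : ∀ (P Q : List Bool) (s : Store), s.inp = List.replicate P.length true ++ false :: rest →
      s.r = P ++ Q → Does (readUnary (case .r (fun b => push .r2 b) skip)) s
        { s with inp := rest, r := Q, r2 := P.reverse ++ s.r2 } (3 * P.length + 2) := by
    intro P Q
    induction P with
    | nil =>
      intro s h h'
      refine Does.of_eq (Does.loop_exit h (.skip _)) ?_ (by simp)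
      simp [Store.set, show Q = s.r from h'.symm]
    | cons b P ih =>
      intro s h h'
      refine Does.of_eq (Does.loop_cons (b := true) h rfl (.case_cons h' (.push _ _ _))
        (ih _ rfl rfl)) ?_ (by simp; omega)
      simp [Store.set, Store.get]
  rw [unary_append] at h
  have hlen : (s.r.take v).length = v := by simp; omega
  have hd : s.r.drop v = s.r[v] :: s.r.drop (v + 1) := List.drop_eq_getElem_cons hv
  have h1 := key (s.r.take v) (s.r.drop v) s (by rw [hlen, h]) (by simp)
  refine Does.of_eq (h1.seq (.seq (.case_cons (b := s.r[v]) (l := s.r.drop (v + 1)) hd (.push _ _ _))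
    (does_move (by decide) (s.r.take v).reverse _ ?_))) ?_ ?_
  · simp [Store.set, Store.get, hr]
  · simp [Store.set, Store.get, hr, List.set_eq_take_append_cons_drop, hv]
  · simp; omega

theorem does_zip (f g : Bool → Bool → Bool) {s : Store} (hl : s.r.length = s.o.length)
    (hr : s.r2 = []) (ho : s.o2 = []) :
    Does (zip f g) s
      { s with r := List.zipWith f s.r s.o, o := List.zipWith g s.r s.o }
      (8 * s.r.length + 3) := by
  have key : ∀ (R O : List Bool) (s : Store), R.length = O.length → s.r = R → s.o = O →
      Does (loop .r false
        (fun x => case .o (fun y => push .r2 (f x y) ;; push .o2 (g x y)) skip)) s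
        { s with r := [], o := [], r2 := (List.zipWith f R O).reverse ++ s.r2
                 o2 := (List.zipWith g R O).reverse ++ s.o2 } (4 * R.length + 1) := by
    intro R
    induction R with
    | nil =>
      intro O s hl h h'
      obtain rfl : O = [] := List.length_eq_zero_iff.1 hl.symm
      refine Does.of_eq (Does.loop_nil h) ?_ (by simp)
      ext1 <;> simp [h, h']
    | cons x R ih =>
      intro O s hl h h'
      obtain ⟨y, O, rfl⟩ := List.exists_cons_of_length_eq_add_one hl.symm
      refine Does.of_eq (Does.loop_cons h rfl (.case_cons h' (.seq (.push _ _ _) (.push _ _ _)))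
        (ih O _ (by simpa using hl) rfl rfl)) ?_ (by simp; omega)
      simp [Store.set, Store.get]
  refine Does.of_eq ((key _ _ s hl rfl rfl).seq (.seq (does_move (by decide) _ _ rfl)
    (does_move (by decide) _ _ rfl))) ?_ ?_
  · simp [Store.set, Store.get, hr, ho]
  · simp [Store.set, Store.get, hr, ho, hl]; omega

theorem does_test {s : Store} (hr : s.r2 = []) (hz : s.z2 = []) :
    Does test s { s with bad := if true ∈ s.r then s.bad else true :: s.bad }
      (7 * s.r.length + 5) := by
  have key : ∀ (R : List Bool) (s : Store), s.r = R →
      Does (loop .r false (fun b => push .r2 b ;; cond b (push .z2 true) skip)) s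
        { s with r := [], r2 := R.reverse ++ s.r2
                 z2 := List.replicate (R.count true) true ++ s.z2 } (3 * R.length + 1) := by
    intro R
    induction R with
    | nil => intro s h; exact Does.of_eq (Does.loop_nil h) (by ext1 <;> simp [h]) (by simp)
    | cons x R ih =>
      intro s h
      cases x
      · exact Does.of_eq (Does.loop_cons (b := false) h rfl (.seq (.push _ _ _) (.skip _))
          (ih _ rfl)) (by simp [Store.set, Store.get]) (by simp; omega)
      · exact Does.of_eq (Does.loop_cons (b := true) h rfl (.seq (.push _ _ _) (.push _ _ _))
          (ih _ rfl)) (by simp [Store.set, Store.get, List.replicate_succ'])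
            (by simp; omega)
  have hc : s.r.count true ≤ s.r.length := List.count_le_length
  by_cases ht : true ∈ s.r
  -- The stack `z2` holds one mark per true bit of the row; only its emptiness matters, and the
  -- marks are cleared afterwards.
  · obtain ⟨m, hm⟩ := Nat.exists_eq_add_one_of_ne_zero (List.count_pos_iff.2 ht).ne'
    refine Does.of_eq ((key _ s rfl).seq (.seq (.case_cons (b := true) (l := List.replicate m true) ?_
      (does_clear _ (List.replicate m true) _ rfl)) (does_move (by decide) s.r.reverse _ ?_)))
      ?_ ?_
    · simp [Store.get, hm, hz, List.replicate_succ]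
    · simp [Store.get, Store.set, hr]
    · simp [Store.get, Store.set, hr, hz, ht]
    · simp; omega
  · have hm : s.r.count true = 0 := List.count_eq_zero.2 ht
    refine Does.of_eq ((key _ s rfl).seq (.seq (.case_nil ?_ (.push _ _ _))
      (does_move (by decide) s.r.reverse _ ?_))) ?_ ?_
    · simp [Store.get, hm, hz]
    · simp [Store.get, Store.set, hr]
    · simp [Store.get, Store.set, hr, hz, ht, hm]
    · simp; omega

theorem does_cmpRow {row rest : List Bool} {s : Store} (h : s.out = row ++ rest)
    (hl : s.r.length = row.length) (hr : s.r2 = []) (ho : s.o2 = []) :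
    Does cmpRow s { s with out := rest, tmp := row.reverse ++ s.tmp
                           z2 := if s.r = row then true :: s.z2 else s.z2 }
      (9 * s.r.length + 4) := by
  -- Here `d` is the number of positions at which the two rows differ, counted in marks on `o2`.
  have key : ∀ (R row : List Bool) (s : Store), R.length = row.length → s.r = R →
      s.out = row ++ rest → ∃ d, d ≤ R.length ∧ (d = 0 ↔ R = row) ∧
      Does (loop .r false (fun x => push .r2 x ;;
        case .out (fun y => push .tmp y ;; cond (x ^^ y) (push .o2 true) skip) skip)) s
        { s with r := [], r2 := R.reverse ++ s.r2, out := rest, tmp := row.reverse ++ s.tmp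
                 o2 := List.replicate d true ++ s.o2 } (5 * R.length + 1) := by
    intro R
    induction R with
    | nil =>
      intro row s hl h h'
      obtain rfl : row = [] := List.length_eq_zero_iff.1 hl.symm
      refine ⟨0, le_rfl, by simp, Does.of_eq (Does.loop_nil h) ?_ (by simp)⟩
      simp only [List.nil_append] at h'
      ext1 <;> simp [h, h']
    | cons x R ih =>
      intro row s hl h h'
      obtain ⟨y, row, rfl⟩ := List.exists_cons_of_length_eq_add_one hl.symm
      have hl' : R.length = row.length := by simpa using hl
      by_cases hxy : x = y
      · obtain ⟨d, hd, hd0, hD⟩ := ih row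
          { s with r := R, r2 := x :: s.r2, out := row ++ rest, tmp := y :: s.tmp } hl' rfl rfl
        refine ⟨d, by simp; omega, by simp [hd0, hxy], ?_⟩
        refine Does.of_eq (Does.loop_cons h rfl (.seq (.push _ _ _) (.case_cons (b := y) h'
          (.seq (.push _ _ _) ?_))) hD) (by simp) (t := 1 + (1 + 1 + 1) + _ + 1)
          (by simp; omega)
        rw [hxy, Bool.xor_self]
        exact .skip _
      · obtain ⟨d, hd, hd0, hD⟩ := ih row
          { s with r := R, r2 := x :: s.r2, out := row ++ rest, tmp := y :: s.tmp
                   o2 := true :: s.o2 } hl' rfl rfl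
        refine ⟨d + 1, by simp; omega, by simp [hxy], ?_⟩
        refine Does.of_eq (Does.loop_cons h rfl (.seq (.push _ _ _) (.case_cons (b := y) h'
          (.seq (.push _ _ _) ?_))) hD) (by simp [List.replicate_succ'])
          (t := 1 + (1 + 1 + 1) + _ + 1) (by simp; omega)
        have : (x ^^ y) = true := by simpa using hxy
        rw [this]
        exact .push _ _ _
  obtain ⟨d, hd, hd0, hD⟩ := key _ _ s hl rfl h
  rcases Nat.eq_zero_or_pos d with h0 | h0
  · refine Does.of_eq (hD.seq (.seq (does_move (by decide) s.r.reverse _ ?_)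
      (.case_nil ?_ (.push _ _ _)))) ?_ ?_
    · simp [Store.get, hr]
    · simp [Store.get, Store.set, ho, h0]
    · simp [Store.get, Store.set, hr, ho, h0, if_pos (hd0.1 h0)]
    · simp; omega
  · obtain ⟨m, rfl⟩ := Nat.exists_eq_add_one_of_ne_zero h0.ne'
    refine Does.of_eq (hD.seq (.seq (does_move (by decide) s.r.reverse _ ?_)
      (.case_cons (b := true) (l := List.replicate m true) ?_
        (does_clear _ (List.replicate m true) _ rfl)))) ?_ ?_
    · simp [Store.get, hr]
    · simp [Store.get, Store.set, ho, List.replicate_succ]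
    · have : s.r ≠ row := fun h => by simpa using hd0.2 h
      simp [Store.get, Store.set, hr, ho, this]
    · simp; omega

/-- The rows in `out` are compared with `r` one at a time and parked on `tmp`, with one mark on `z2`
for each match. Positivity of `N` is essential: rows of length 0 would leave `out` empty, and the
loop would not see them. -/
theorem does_insertRow {N : ℕ} (hN : 0 < N) {rows : List (List Bool)}
    (hrows : ∀ row ∈ rows, row.length = N) {s : Store} (hR : s.r.length = N)
    (h : s.out = rows.flatten) (hr : s.r2 = []) (ho : s.o2 = []) (hz : s.z2 = [])
    (ht : s.tmp = []) :
    Does insertRow s { s with out := (rows.insert s.r).flatten, r := [] }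
      ((rows.length + 1) * (11 * N + 8)) := by
  have key : ∀ (rows : List (List Bool)) (s : Store), (∀ row ∈ rows, row.length = N) →
      s.r.length = N → s.out = rows.flatten → s.r2 = [] → s.o2 = [] →
      ∃ d, d ≤ rows.length ∧ (d = 0 ↔ s.r ∉ rows) ∧ Does (whileNonempty .out cmpRow) s
        { s with out := [], tmp := rows.flatten.reverse ++ s.tmp
                 z2 := List.replicate d true ++ s.z2 } (rows.length * (9 * N + 6) + 1) := by
    intro rows
    induction rows with
    | nil =>
      intro s _ _ h _ _
      exact ⟨0, le_rfl, by simp, Does.of_eq (Does.loop_nil h) (by ext1 <;> simp [h]) (by simp)⟩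
    | cons row rows ih =>
      intro s hrows hR h hr ho
      have hlen := hrows row (by simp)
      have h1 := does_cmpRow (s := s) (row := row) (rest := rows.flatten) (by simpa using h)
        (by omega) hr ho
      have hne : s.get .out ≠ [] := by
        have : s.get .out = row ++ rows.flatten := by simpa [Store.get] using h
        rw [this]
        intro h0
        simp at h0
        simp [h0.1] at hlen
        omega
      obtain ⟨d, hd, hd0, hD⟩ := ih
        { s with out := rows.flatten, tmp := row.reverse ++ s.tmp
                 z2 := if s.r = row then true :: s.z2 else s.z2 }
        (fun r hr => hrows r (by simp [hr])) hR rfl hr ho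
      refine ⟨if s.r = row then d + 1 else d, by split_ifs <;> simp <;> omega, ?_,
        Does.of_eq (does_while hne h1 hD) ?_ ?_⟩
      · split_ifs with hrow <;> simp_all
      · split_ifs with hrow <;> simp [List.replicate_succ', hrow]
      · rw [hR, List.length_cons, Nat.add_mul]; omega
  obtain ⟨d, hd, hd0, hD⟩ := key rows s hrows hR h hr ho
  have hfl : rows.flatten.length = rows.length * N := by
    rw [List.length_flatten, List.sum_eq_card_nsmul _ N (by simpa using hrows)]
    simp
  -- The summands pay for the comparisons, pouring `tmp` back, clearing at most one mark per row,
  -- and moving the row `r` twice.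
  have hmul : rows.length * (9 * N + 6) + 2 * (rows.length * N) + 2 * rows.length + 4 * N + 8
      ≤ (rows.length + 1) * (11 * N + 8) := by nlinarith
  rcases Nat.eq_zero_or_pos d with h0 | h0
  · refine Does.of_eq (hD.seq (.seq (does_move (by decide) rows.flatten.reverse _ ?_) (.case_nil ?_
      (.seq (does_move (by decide) s.r _ ?_) (does_move (by decide) s.r.reverse _ ?_)))))
      ?_ ?_
    · simp [Store.get, ht]
    · simp [Store.get, Store.set, h0, hz]
    · simp [Store.get, Store.set]
    · simp [Store.get, Store.set, hr]
    · simp [Store.get, Store.set, hr, ht, h0, hz, List.insert_of_not_mem (hd0.1 h0)]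
    · simp only [List.length_reverse, hfl, hR]; omega
  · obtain ⟨m, rfl⟩ := Nat.exists_eq_add_one_of_ne_zero h0.ne'
    have hmem : s.r ∈ rows := by
      by_contra hc
      simpa using hd0.2 hc
    refine Does.of_eq (hD.seq (.seq (does_move (by decide) rows.flatten.reverse _ ?_)
      (.case_cons (b := true) (l := List.replicate m true) ?_
      (.seq (does_clear _ (List.replicate m true) _ ?_) (does_clear _ s.r _ ?_))))) ?_ ?_
    · simp [Store.get, ht]
    · simp [Store.get, Store.set, hz, List.replicate_succ]
    · simp [Store.get, Store.set]
    · simp [Store.get, Store.set]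
    · simp [Store.get, Store.set, ht, hz, List.insert_of_mem hmem]
    · simp only [List.length_reverse, List.length_replicate, hfl, hR]; omega

/-! ### Instances as lists of numbers -/

/-- The relation `{0,1}^w` without the tuple that is constantly `β`. -/
def relOf (β : Bool) (w : ℕ) : BoolRel := ⟨w, Finset.univ \ {fun _ => β}⟩

/-- The language consisting of `relOf β w` and the pins. -/
def lang (β : Bool) (w : ℕ) : ConstraintLanguage := [relOf β w] ++ pins

/-- The position in `lang β w` of the relation that pins a variable to `β`. -/
def pinIdx (β : Bool) : ℕ := bif β then 2 else 1

/-- A constraint as a pair of the position of its relation and the list of its variables. -/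
def toRaw {Γ : ConstraintLanguage} {n : ℕ} (c : Constraint Γ (Fin n)) : ℕ × List ℕ :=
  (c.1, List.ofFn fun j => (c.2 j : ℕ))

/-- The constraint `c` holds for the assignment that gives the value `β` exactly to the variables
in `S`, if `p` is the position of the relation that pins a variable to `β`. -/
def RawSat (p : ℕ) (S : Finset ℕ) (c : ℕ × List ℕ) : Prop :=
  if c.1 = 0 then ∃ v ∈ c.2, v ∉ S else if c.1 = p then ∀ v ∈ c.2, v ∈ S else ∀ v ∈ c.2, v ∉ S

/-- The number of satisfying assignments of a list of constraints on `n` variables. -/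
noncomputable def rawCount (p n : ℕ) (raws : List (ℕ × List ℕ)) : ℕ :=
  Nat.card {S : Finset ℕ // S ⊆ Finset.range n ∧ ∀ c ∈ raws, RawSat p S c}

/-- The word that consists of a number of variables and of the codes of constraints. -/
def rawWord (n : ℕ) (raws : List (ℕ × List ℕ)) : List Bool := unary n ++ raws.flatMap rawCode

/-- The list describes the constraints of an instance over `lang β w` with `n` variables and of
degree at most `d`. -/
structure RawCSP (d w n : ℕ) (raws : List (ℕ × List ℕ)) : Prop where
  nodup : raws.Nodup
  idx : ∀ c ∈ raws, c.1 < 3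
  len : ∀ c ∈ raws, c.2.length = if c.1 = 0 then w else 1
  lt : ∀ c ∈ raws, ∀ v ∈ c.2, v < n
  deg : ∀ v, (raws.map fun c => c.2.count v).sum ≤ d

/-! ### Equivalence of CSP instances with lists of numbers -/

theorem countP_finRange {n : ℕ} (p : Fin n → Bool) :
    (List.finRange n).countP p = (Finset.univ.filter fun v => p v = true).card := by
  rw [List.countP_eq_length_filter,
    ← List.toFinset_card_of_nodup ((List.nodup_finRange n).filter _), List.toFinset_filter,
    List.toFinset_finRange]

theorem toRaw_injective {Γ : ConstraintLanguage} {n : ℕ} :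
    Function.Injective (toRaw : Constraint Γ (Fin n) → ℕ × List ℕ) := by
  rintro ⟨i, f⟩ ⟨i', f'⟩ h
  simp only [toRaw, Prod.mk.injEq] at h
  obtain ⟨h1, h2⟩ := h
  obtain rfl : i = i' := Fin.ext h1
  have := List.ofFn_injective h2
  congr 1
  funext j
  exact Fin.ext (congrFun this j)

theorem rawCode_toRaw {Γ : ConstraintLanguage} {n : ℕ} (c : Constraint Γ (Fin n)) :
    rawCode (toRaw c) = encodeConstraint c := by
  simp [rawCode, toRaw, encodeConstraint, List.flatMap_def, List.map_ofFn, Function.comp_def]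

theorem arity_lang (β : Bool) (w : ℕ) (i : Fin (lang β w).length) :
    ((lang β w).get i).arity = if (i : ℕ) = 0 then w else 1 := by
  obtain ⟨i, hi⟩ := i
  have hi' : i < 3 := hi
  interval_cases i <;> rfl

theorem exists_toRaw_eq {β : Bool} {w n : ℕ} {c : ℕ × List ℕ} (hi : c.1 < 3)
    (hl : c.2.length = if c.1 = 0 then w else 1) (hlt : ∀ v ∈ c.2, v < n) :
    ∃ c' : Constraint (lang β w) (Fin n), toRaw c' = c := by
  obtain ⟨i, l⟩ := c
  have ha : ((lang β w).get ⟨i, hi⟩).arity = l.length := by rw [arity_lang]; exact hl.symm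
  refine ⟨⟨⟨i, hi⟩, fun j => ⟨l[(j : ℕ)]'(ha ▸ j.2), hlt _ (List.getElem_mem _)⟩⟩, ?_⟩
  simp only [toRaw, Prod.mk.injEq, true_and]
  exact List.ext_getElem (by rw [List.length_ofFn]; exact ha) (by simp)

theorem rawSat_relOf {β : Bool} {p w n : ℕ} (f : Fin w → Fin n) (a : Fin n → Bool)
    (S : Finset ℕ) (hS : ∀ v : Fin n, (v : ℕ) ∈ S ↔ a v = β) :
    (fun j => a (f j)) ∈ (relOf β w).tuples ↔ RawSat p S (0, List.ofFn fun j => (f j : ℕ)) := by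
  change (fun j => a (f j)) ∈ (Finset.univ \ {fun _ => β} : Finset (Fin w → Bool)) ↔ _
  rw [Finset.mem_sdiff, Finset.mem_singleton, funext_iff]
  simp [RawSat, hS]

theorem rawSat_pin {β b : Bool} {n : ℕ} (f : Fin 1 → Fin n) (a : Fin n → Bool)
    (S : Finset ℕ) (hS : ∀ v : Fin n, (v : ℕ) ∈ S ↔ a v = β) :
    (fun j => a (f j)) ∈ ({fun _ => b} : Finset (Fin 1 → Bool)) ↔
      RawSat (pinIdx β) S (pinIdx b, List.ofFn fun j => (f j : ℕ)) := by
  cases β <;> cases b <;> simp [pinIdx, RawSat, funext_iff, hS]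

/-- Passing from an assignment to its set of `β`-valued variables makes the satisfaction condition
independent of `β`, except for which position plays the role of the pin into the set. -/
theorem rawSat_toRaw {β : Bool} {w n : ℕ} (c : Constraint (lang β w) (Fin n)) (a : Fin n → Bool)
    (S : Finset ℕ) (hS : ∀ v : Fin n, (v : ℕ) ∈ S ↔ a v = β) :
    (fun j => a (c.2 j)) ∈ ((lang β w).get c.1).tuples ↔ RawSat (pinIdx β) S (toRaw c) := by
  obtain ⟨⟨i, hi⟩, f⟩ := c
  have hi' : i < 3 := hi
  interval_cases i
  · exact rawSat_relOf f a S hS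
  · exact rawSat_pin (b := false) f a S hS
  · exact rawSat_pin (b := true) f a S hS

/-- Assignments of Boolean values to `n` variables correspond to sets of numbers below `n`. -/
def assignEquiv (β : Bool) (n : ℕ) : (Fin n → Bool) ≃ {S : Finset ℕ // S ⊆ Finset.range n} where
  toFun a := ⟨(Finset.univ.filter fun v => a v = β).map Fin.valEmbedding, by
    intro v hv
    simp only [Finset.mem_map] at hv
    obtain ⟨v, -, rfl⟩ := hv
    exact Finset.mem_range.2 v.2⟩
  invFun S v := if (v : ℕ) ∈ S.1 then β else !β
  left_inv a := by
    funext v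
    by_cases h : a v = β
    · simp [h, Fin.val_inj]
    · have : a v = !β := by cases h' : a v <;> cases β <;> simp_all
      simp [this, Fin.val_inj]
  right_inv S := by
    ext v
    simp only [Finset.mem_map, Finset.mem_filter, Finset.mem_univ, true_and]
    constructor
    · rintro ⟨v, hv, rfl⟩
      by_contra h
      exact absurd ((if_neg h).symm.trans hv) (by simp)
    · intro hv
      exact ⟨⟨v, Finset.mem_range.1 (S.2 hv)⟩, by simp [hv], rfl⟩

theorem mem_assignEquiv {β : Bool} {n : ℕ} (a : Fin n → Bool) (v : Fin n) :
    (v : ℕ) ∈ (assignEquiv β n a).1 ↔ a v = β := by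
  simp [assignEquiv, Fin.val_inj]

theorem numSat_eq_rawCount {β : Bool} {w : ℕ} (I : CSPInstance (lang β w))
    (L : List (Constraint (lang β w) (Fin I.n))) (hL : L.toFinset = I.constraints) :
    I.numSat = rawCount (pinIdx β) I.n (L.map toRaw) := by
  rw [CSPInstance.numSat, rawCount]
  refine Nat.card_congr (((assignEquiv β I.n).subtypeEquiv (q := fun S =>
    ∀ c ∈ L.map toRaw, RawSat (pinIdx β) S.1 c) fun a => ?_).trans
    (Equiv.subtypeSubtypeEquivSubtypeInter _ fun S => ∀ c ∈ L.map toRaw, RawSat (pinIdx β) S c))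
  simp only [CSPInstance.Satisfies, ← hL, List.mem_toFinset, List.mem_map, forall_exists_index,
    and_imp, forall_apply_eq_imp_iff₂]
  exact forall₂_congr fun c _ => rawSat_toRaw c a _ fun v => mem_assignEquiv a v

theorem occurrences_eq_sum {β : Bool} {w : ℕ} (I : CSPInstance (lang β w))
    (L : List (Constraint (lang β w) (Fin I.n))) (hnd : L.Nodup) (hL : L.toFinset = I.constraints)
    (v : Fin I.n) : I.occurrences v = ((L.map toRaw).map fun c => c.2.count (v : ℕ)).sum := by
  rw [CSPInstance.occurrences, ← hL, List.sum_toFinset _ hnd, List.map_map]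
  refine congrArg _ (List.map_congr_left fun c _ => ?_)
  simp only [Function.comp, toRaw, List.ofFn_eq_map, List.count, List.countP_map]
  rw [countP_finRange]
  congr 1
  ext j
  simp [Fin.ext_iff]

theorem exists_raw_of_encodes {β : Bool} {d w : ℕ} {I : (countCSP d (lang β w)).Inst}
    {x : List Bool} (h : (countCSP d (lang β w)).Encodes x I) :
    ∃ n raws, RawCSP d w n raws ∧ x = rawWord n raws ∧
      (countCSP d (lang β w)).count I = rawCount (pinIdx β) n raws := by
  obtain ⟨I, hI⟩ := I
  obtain ⟨L, hnd, hL, rfl⟩ := h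
  have hmem : ∀ {P : ℕ × List ℕ → Prop}, (∀ c ∈ L, P (toRaw c)) → ∀ c ∈ L.map toRaw, P c := by
    intro P hP c hc
    obtain ⟨c', hc', rfl⟩ := List.mem_map.1 hc
    exact hP c' hc'
  have hlt : ∀ c ∈ L.map toRaw, ∀ v ∈ c.2, v < I.n := by
    refine hmem fun c _ v hv => ?_
    simp only [toRaw, List.mem_ofFn] at hv
    obtain ⟨j, rfl⟩ := hv
    exact (c.2 j).2
  refine ⟨I.n, L.map toRaw, ⟨hnd.map toRaw_injective, hmem fun c _ => c.1.2,
    hmem fun c _ => ?_, hlt, fun v => ?_⟩, ?_, numSat_eq_rawCount I L hL⟩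
  · simp only [toRaw, List.length_ofFn]
    exact arity_lang β w c.1
  · by_cases hv : v < I.n
    · rw [← occurrences_eq_sum I L hnd hL ⟨v, hv⟩]
      exact (Finset.le_sup (f := I.occurrences) (Finset.mem_univ _)).trans hI
    -- A number that is not a variable of the instance occurs in no scope.
    · have : ((L.map toRaw).map fun c => c.2.count v) =
          List.replicate (L.map toRaw).length 0 :=
        List.map_eq_replicate_iff.2 fun c hc =>
          List.count_eq_zero.2 fun hm => hv (hlt c hc v hm)
      rw [this]
      simp
  · simp only [rawWord, List.flatMap_map, rawCode_toRaw]

/-- The bounds on positions, lengths and variables are exactly what is needed to lift every pair to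
a typed constraint. The order of the list is kept, so the word encodes the lifted instance. -/
theorem exists_encodes_of_raw (β : Bool) {d w n : ℕ} {raws : List (ℕ × List ℕ)}
    (h : RawCSP d w n raws) :
    ∃ I : (countCSP d (lang β w)).Inst, (countCSP d (lang β w)).Encodes (rawWord n raws) I ∧
      (countCSP d (lang β w)).count I = rawCount (pinIdx β) n raws := by
  have : raws ∈ Set.range (List.map (toRaw : Constraint (lang β w) (Fin n) → _)) := by
    rw [Set.range_list_map]
    exact fun c hc => exists_toRaw_eq (h.idx c hc) (h.len c hc) (h.lt c hc)
  obtain ⟨L, rfl⟩ := this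
  have hnd : L.Nodup := List.Nodup.of_map _ h.nodup
  classical
  let I : CSPInstance (lang β w) := ⟨n, L.toFinset⟩
  refine ⟨⟨I, Finset.sup_le fun v _ => ?_⟩, ⟨L, hnd, ?_, ?_⟩, ?_⟩
  · rw [occurrences_eq_sum I L hnd (by ext c; simp [I])]
    exact h.deg v
  · ext c; simp [I]
  · simp only [rawWord, List.flatMap_map, rawCode_toRaw]; rfl
  · exact numSat_eq_rawCount I L (by ext c; simp [I])

/-! ### Equivalence of hypergraphs with lists of characteristic vectors -/

/-- The number of independent sets of the hypergraph on `n` vertices whose hyper-edges have the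
given characteristic vectors. -/
noncomputable def rowCount (n : ℕ) (rows : List (List Bool)) : ℕ :=
  Nat.card {S : Finset ℕ // S ⊆ Finset.range n ∧
    ∀ r ∈ rows, ∃ v, r.getD v false = true ∧ v ∉ S}

/-- The list consists of the characteristic vectors of the hyper-edges of a hypergraph with `n`
vertices, of width `w` and of degree at most `d`. -/
structure RawHypergraph (d w n : ℕ) (rows : List (List Bool)) : Prop where
  nodup : rows.Nodup
  len : ∀ r ∈ rows, r.length = n
  pos : ∀ r ∈ rows, true ∈ r
  le : ∀ r ∈ rows, r.count true ≤ w
  ex : ∃ r ∈ rows, r.count true = w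
  deg : ∀ v, rows.countP (fun r => r.getD v false) ≤ d

/-- The characteristic vector of a set. -/
def toRow {n : ℕ} (e : Finset (Fin n)) : List Bool := List.ofFn fun v => decide (v ∈ e)

theorem getD_toRow {n : ℕ} (e : Finset (Fin n)) (v : ℕ) :
    (toRow e).getD v false = true ↔ ∃ h : v < n, (⟨v, h⟩ : Fin n) ∈ e := by
  by_cases h : v < n <;> simp [toRow, List.getD_eq_getElem?_getD, h]

theorem toRow_injective {n : ℕ} : Function.Injective (toRow : Finset (Fin n) → List Bool) := by
  intro e e' h
  ext v
  have h1 := getD_toRow e v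
  have h2 := getD_toRow e' v
  rw [h] at h1
  simpa using h1.symm.trans h2

theorem count_toRow {n : ℕ} (e : Finset (Fin n)) : (toRow e).count true = e.card := by
  simp only [toRow, List.ofFn_eq_map, List.count, List.countP_map]
  rw [countP_finRange]
  congr 1
  ext v
  simp

theorem true_mem_toRow {n : ℕ} {e : Finset (Fin n)} : true ∈ toRow e ↔ e.Nonempty := by
  rw [← List.count_pos_iff, count_toRow, Finset.card_pos]

theorem numIndep_eq_rowCount (H : Hypergraph) (L : List (Finset (Fin H.n)))
    (hL : L.toFinset = H.edges) : H.numIndep = rowCount H.n (L.map toRow) := by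
  let φ : Finset (Fin H.n) ≃ {S : Finset ℕ // S ⊆ Finset.range H.n} :=
    { toFun := fun S => ⟨S.map Fin.valEmbedding, by
        intro v hv
        simp only [Finset.mem_map] at hv
        obtain ⟨v, -, rfl⟩ := hv
        exact Finset.mem_range.2 v.2⟩
      invFun := fun S => Finset.univ.filter fun v => (v : ℕ) ∈ S.1
      left_inv := fun S => by ext v; simp [Fin.val_inj]
      right_inv := fun S => by
        ext v
        simp only [Finset.mem_map, Finset.mem_filter, Finset.mem_univ, true_and]
        exact ⟨by rintro ⟨v, hv, rfl⟩; exact hv,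
          fun hv => ⟨⟨v, Finset.mem_range.1 (S.2 hv)⟩, hv, rfl⟩⟩ }
  rw [Hypergraph.numIndep, rowCount]
  refine Nat.card_congr ((φ.subtypeEquiv (q := fun S =>
    ∀ r ∈ L.map toRow, ∃ v, r.getD v false = true ∧ v ∉ S.1) fun S => ?_).trans
    (Equiv.subtypeSubtypeEquivSubtypeInter _ fun S =>
      ∀ r ∈ L.map toRow, ∃ v, r.getD v false = true ∧ v ∉ S))
  simp only [Hypergraph.Independent, ← hL, List.mem_toFinset, List.mem_map, forall_exists_index,
    and_imp, forall_apply_eq_imp_iff₂, getD_toRow]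
  refine forall₂_congr fun e _ => ?_
  rw [Finset.not_subset]
  constructor
  · rintro ⟨v, hv, hS⟩
    exact ⟨v, ⟨v.2, hv⟩, by simpa [φ, Fin.val_inj] using hS⟩
  · rintro ⟨v, ⟨h, hv⟩, hS⟩
    refine ⟨⟨v, h⟩, hv, fun hm => hS ?_⟩
    exact Finset.mem_map.2 ⟨_, hm, rfl⟩

theorem degree_eq_countP (H : Hypergraph) (L : List (Finset (Fin H.n))) (hnd : L.Nodup)
    (hL : L.toFinset = H.edges) (v : Fin H.n) :
    (H.edges.filter fun e => v ∈ e).card =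
      (L.map toRow).countP fun r => r.getD (v : ℕ) false := by
  rw [← hL, List.countP_map, List.countP_eq_length_filter,
    ← List.toFinset_card_of_nodup (hnd.filter _), List.toFinset_filter]
  congr 1
  ext e
  simp only [Finset.mem_filter, Function.comp, getD_toRow]
  simp

theorem exists_rows_of_encodes {d w : ℕ} (hw : 0 < w) {I : (countHIS w d).Inst} {x : List Bool}
    (h : (countHIS w d).Encodes x I) :
    ∃ n rows, RawHypergraph d w n rows ∧ x = unary n ++ rows.flatten ∧
      (countHIS w d).count I = rowCount n rows := by
  obtain ⟨H, hwd, hd⟩ := I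
  obtain ⟨L, hnd, hL, rfl⟩ := h
  have hmem : ∀ {P : List Bool → Prop}, (∀ e ∈ H.edges, P (toRow e)) → ∀ r ∈ L.map toRow, P r := by
    intro P hP r hr
    obtain ⟨e, he, rfl⟩ := List.mem_map.1 hr
    exact hP e (hL ▸ List.mem_toFinset.2 he)
  refine ⟨H.n, L.map toRow, ⟨hnd.map toRow_injective, hmem fun e _ => by simp [toRow],
    hmem fun e he => true_mem_toRow.2 (H.nonempty e he), hmem fun e he => ?_, ?_, fun v => ?_⟩, ?_,
    numIndep_eq_rowCount H L hL⟩
  · rw [count_toRow, ← hwd]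
    exact Finset.le_sup (f := Finset.card) he
  -- The supremum over no hyper-edges is 0, so positive width forces a hyper-edge, and then the
  -- width is attained.
  · have hne : H.edges.Nonempty := by
      rw [Finset.nonempty_iff_ne_empty]
      intro h0
      simp [Hypergraph.width, h0] at hwd
      omega
    obtain ⟨e, he, hc⟩ := Finset.exists_mem_eq_sup _ hne Finset.card
    refine ⟨toRow e, List.mem_map_of_mem (List.mem_toFinset.1 (hL ▸ he)), ?_⟩
    rw [count_toRow, ← hc]
    exact hwd
  · by_cases hv : v < H.n
    · rw [← degree_eq_countP H L hnd hL ⟨v, hv⟩]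
      exact (Finset.le_sup (f := fun v => (H.edges.filter fun e => v ∈ e).card)
        (Finset.mem_univ _)).trans hd
    · rw [List.countP_eq_zero.2]
      · exact Nat.zero_le _
      · refine hmem fun e _ => ?_
        rw [getD_toRow]
        exact fun ⟨h, _⟩ => hv h
  · rw [List.flatMap_def]; rfl

theorem exists_encodes_of_rows {d w n : ℕ} {rows : List (List Bool)}
    (h : RawHypergraph d w n rows) :
    ∃ I : (countHIS w d).Inst, (countHIS w d).Encodes (unary n ++ rows.flatten) I ∧
      (countHIS w d).count I = rowCount n rows := by
  have : rows ∈ Set.range (List.map (toRow : Finset (Fin n) → _)) := by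
    rw [Set.range_list_map]
    intro r hr
    have hl := h.len r hr
    refine ⟨Finset.univ.filter fun v => r.getD (v : ℕ) false = true, ?_⟩
    apply List.ext_getElem
    · simp [toRow, hl]
    · intro i h1 h2
      simp [toRow, List.getD_eq_getElem?_getD, h2]
  obtain ⟨L, rfl⟩ := this
  have hnd : L.Nodup := List.Nodup.of_map _ h.nodup
  let H : Hypergraph := ⟨n, L.toFinset, fun e he =>
    true_mem_toRow.1 (h.pos _ (List.mem_map_of_mem (List.mem_toFinset.1 he)))⟩
  refine ⟨⟨H, le_antisymm (Finset.sup_le fun e he => ?_) ?_, Finset.sup_le fun v _ => ?_⟩,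
    ⟨L, hnd, rfl, ?_⟩, ?_⟩
  · rw [← count_toRow]
    exact h.le _ (List.mem_map_of_mem (List.mem_toFinset.1 he))
  · obtain ⟨r, hr, hc⟩ := h.ex
    obtain ⟨e, he, rfl⟩ := List.mem_map.1 hr
    rw [← hc, count_toRow]
    exact Finset.le_sup (f := Finset.card) (List.mem_toFinset.2 he)
  · exact (degree_eq_countP H L hnd rfl v).trans_le (h.deg v)
  · rw [List.flatMap_def]; rfl
  · exact numIndep_eq_rowCount H L rfl

/-! ### Flipping the values of the variables -/

/-- Interchange the positions of the two pins. -/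
def swapIdx (i : ℕ) : ℕ := if i = 0 then 0 else 3 - i

/-- Interchange the two pins, and reverse the scope. -/
def rawSwap (c : ℕ × List ℕ) : ℕ × List ℕ := (swapIdx c.1, c.2.reverse)

namespace Cmd

/-- Copy a number in unary from the input to the output. -/
def copyNum : Cmd := push .out false ;; readUnary (push .out true)

/-- The program that interchanges the pins. -/
def swapProg (w : ℕ) : Cmd :=
  readUnary (push .z true) ;;
    dispatch (fun i => rep (if i = 0 then w else 1) copyNum ;;
      pushList .out (unary (swapIdx i)).reverse) ;;
    push .out false ;; move .z .out

end Cmd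

@[simp] theorem length_unary (v : ℕ) : (unary v).length = v + 1 := by simp [unary]

/-- The output is a stack, so words are built from right to left: the terminating 0 of each number
is pushed first, and the numbers come out in reverse order. Reversing a scope is harmless because
all relations involved are symmetric. -/
theorem does_rep_copyNum (l : List ℕ) (rest : List Bool) (s : Store)
    (h : s.inp = l.flatMap unary ++ rest) :
    Does (rep l.length copyNum) s
      { s with inp := rest, out := l.reverse.flatMap unary ++ s.out }
      (3 * (l.flatMap unary).length + 1) := by
  induction l generalizing s with
  | nil => exact Does.of_eq (.skip _) (by ext1 <;> simp_all) (by simp)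
  | cons v l ih =>
    simp only [List.flatMap_cons, List.append_assoc] at h
    refine Does.of_eq (.seq (.seq (.push _ _ _)
      (does_readUnary_push (by decide) (l.flatMap unary ++ rest) v _ h)) (ih _ rfl)) ?_ ?_
    · simp [Store.set, Store.get, unary]
    · simp only [List.flatMap_cons, List.length_append, length_unary]; omega

theorem does_dispatch_swap {w : ℕ} (raws : List (ℕ × List ℕ)) (hidx : ∀ c ∈ raws, c.1 < 3)
    (hlen : ∀ c ∈ raws, c.2.length = if c.1 = 0 then w else 1) (s : Store)
    (h : s.inp = raws.flatMap rawCode) :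
    Does (dispatch (fun i => rep (if i = 0 then w else 1) copyNum ;;
        pushList .out (unary (swapIdx i)).reverse)) s
      { s with inp := [], out := (raws.map rawSwap).reverse.flatMap rawCode ++ s.out }
      (10 * (raws.flatMap rawCode).length + 1) := by
  induction raws generalizing s with
  | nil => exact Does.of_eq (does_dispatch_nil _ _ h) (by ext1 <;> simp_all) (by simp)
  | cons c raws ih =>
    obtain ⟨i, l⟩ := c
    have hi := hidx (i, l) (by simp)
    have hl := hlen (i, l) (by simp)
    simp only at hi hl
    rw [List.flatMap_cons] at h
    refine Does.of_eq (does_dispatch_cons h hi rfl (.seq (hl ▸ does_rep_copyNum l _ _ rfl)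
      (does_pushList _ _ _)) (ih (fun c hc => hidx c (by simp [hc]))
        (fun c hc => hlen c (by simp [hc])) _ rfl)) ?_ ?_
    · simp [Store.set, Store.get, rawSwap, rawCode]
    · have : swapIdx i ≤ 2 := by unfold swapIdx; split_ifs <;> omega
      simp only [List.flatMap_cons, List.length_append, rawCode, length_unary,
        List.length_reverse]
      omega

theorem does_swapProg {w n : ℕ} (raws : List (ℕ × List ℕ)) (hidx : ∀ c ∈ raws, c.1 < 3)
    (hlen : ∀ c ∈ raws, c.2.length = if c.1 = 0 then w else 1) (k : ℕ) :
    Does (swapProg w) (initStore (rawWord n raws) k)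
      { eps := List.replicate k true, out := rawWord n (raws.map rawSwap).reverse }
      (10 * (rawWord n raws).length) := by
  refine Does.of_eq (.seq (does_readUnary_push (by decide) (raws.flatMap rawCode) n _ rfl)
    (.seq (does_dispatch_swap raws hidx hlen _ rfl)
    (.seq (.push _ _ _) (does_move (by decide) (List.replicate n true) _ ?_)))) ?_ ?_
  · simp [Store.set, Store.get, initStore]
  · simp [Store.set, Store.get, initStore, rawWord, unary]
  · simp [rawWord]; omega

theorem swapIdx_swapIdx {i : ℕ} (hi : i < 3) : swapIdx (swapIdx i) = i := by
  interval_cases i <;> rfl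

theorem RawCSP.swap {d w n : ℕ} {raws : List (ℕ × List ℕ)} (h : RawCSP d w n raws) :
    RawCSP d w n (raws.map rawSwap).reverse where
  nodup := by
    refine List.nodup_reverse.2 (List.Nodup.map_on ?_ h.nodup)
    rintro ⟨i, l⟩ hc ⟨i', l'⟩ hc' he
    -- Subtraction is truncated, so `swapIdx` is an involution only on the positions below 3; this
    -- is why injectivity is proved on the list rather than globally.
    simp only [rawSwap, Prod.mk.injEq, List.reverse_inj] at he
    have h1 := swapIdx_swapIdx (h.idx _ hc)
    have h2 := swapIdx_swapIdx (h.idx _ hc')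
    simp only at h1 h2
    rw [← h1, ← h2, he.1, he.2]
  idx := by
    simp only [List.mem_reverse, List.mem_map, forall_exists_index, and_imp,
      forall_apply_eq_imp_iff₂]
    intro c hc
    simp only [rawSwap, swapIdx]
    split_ifs <;> omega
  len := by
    simp only [List.mem_reverse, List.mem_map, forall_exists_index, and_imp,
      forall_apply_eq_imp_iff₂]
    intro c hc
    have h1 := h.idx c hc
    have h2 := h.len c hc
    simp only [rawSwap, List.length_reverse, h2, swapIdx]
    split_ifs <;> omega
  lt := by
    simp only [List.mem_reverse, List.mem_map, forall_exists_index, and_imp,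
      forall_apply_eq_imp_iff₂, rawSwap]
    exact h.lt
  deg v := by
    rw [List.map_reverse, List.sum_reverse, List.map_map]
    simpa [Function.comp_def, rawSwap] using h.deg v

/-- Negating `β` while keeping the set `S` complements the assignment: this exchanges the pins and
turns OR into NAND. -/
theorem rawSat_rawSwap {β : Bool} {S : Finset ℕ} {c : ℕ × List ℕ} (hc : c.1 < 3) :
    RawSat (pinIdx !β) S (rawSwap c) ↔ RawSat (pinIdx β) S c := by
  obtain ⟨i, l⟩ := c
  simp only at hc
  interval_cases i <;> cases β <;> simp [RawSat, rawSwap, swapIdx, pinIdx]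

theorem rawCount_swap {β : Bool} {n : ℕ} {raws : List (ℕ × List ℕ)}
    (h : ∀ c ∈ raws, c.1 < 3) :
    rawCount (pinIdx !β) n (raws.map rawSwap).reverse = rawCount (pinIdx β) n raws := by
  refine Nat.card_congr (Equiv.subtypeEquivRight fun S => and_congr_right fun _ => ?_)
  simp only [List.mem_reverse, List.mem_map, forall_exists_index, and_imp,
    forall_apply_eq_imp_iff₂]
  exact forall₂_congr fun c hc => rawSat_rawSwap (h c hc)

theorem apReducible_flip (β : Bool) (d w : ℕ) :
    APReducible (countCSP d (lang β w)) (countCSP d (lang (!β) w)) := by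
  refine apReducible_of_does (swapProg w) 10 1 fun I x hx k => ?_
  obtain ⟨n, raws, hraw, rfl, hcount⟩ := exists_raw_of_encodes hx
  obtain ⟨J, hJ, hJc⟩ := exists_encodes_of_raw (!β) hraw.swap
  refine ⟨_, (does_swapProg raws hraw.idx hraw.len k).weaken ?_, rfl, .inr ⟨rfl, by simp, J, hJ, ?_⟩⟩
  · have : (rawWord n raws).length ≤ ((rawWord n raws).length + 1) ^ 3 :=
      (Nat.le_succ _).trans (Nat.le_self_pow (by norm_num) _)
    omega
  · rw [hJc, hcount, rawCount_swap hraw.idx]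

/-! ### From hypergraphs to constraints -/

/-- The positions of the true bits of a row, if its first position is `v`. -/
def trueIdx : ℕ → List Bool → List ℕ
  | _, [] => []
  | v, b :: R => if b then v :: trueIdx (v + 1) R else trueIdx (v + 1) R

/-- The number of new variables that are needed to fill up the scope of a hyper-edge. -/
def slack (w : ℕ) (R : List Bool) : ℕ := w - R.count true

/-- The constraints that stand for hyper-edges, `f` being the first new variable. -/
def edgeRaws (w : ℕ) : ℕ → List (List Bool) → List (ℕ × List ℕ)
  | _, [] => []
  | f, R :: rows => (0, (trueIdx 0 R ++ List.range' f (slack w R)).reverse) ::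
      edgeRaws w (f + slack w R) rows

/-- The number of new variables. -/
def totalSlack (w : ℕ) (rows : List (List Bool)) : ℕ := (rows.map (slack w)).sum

/-- The constraints that pin the new variables. -/
def pinRaws (p f m : ℕ) : List (ℕ × List ℕ) := (List.range' f m).map fun v => (p, [v])

namespace Cmd

/-- Write the length of a stack in unary. -/
def emit (k : Stk) : Cmd :=
  push .out false ;; loop k false (fun b => push .r2 b ;; push .out true) ;; move .r2 k

/-- Read a row and write the positions of its true bits. -/
def scanRow : Cmd :=
  loop .z false fun b => push .z2 b ;;
    case .inp (fun x => cond x (emit .r ;; case .a (fun _ => skip) skip) skip) skip ;; push .r true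

/-- Write new variables, one for each element of the stack `a`. -/
def fillScope : Cmd := loop .a false fun _ => emit .o ;; push .o true ;; push .tmp true

/-- Read a row and write the constraint that stands for the hyper-edge. -/
def edgeCmd (w : ℕ) : Cmd :=
  pushList .a (List.replicate w true) ;; scanRow ;; move .z2 .z ;; clear .r ;; fillScope ;;
    push .out false

/-- Write the constraints that pin the new variables. -/
def pinCmd (p : ℕ) : Cmd :=
  loop .tmp false fun _ => emit .r ;; pushList .out (unary p).reverse ;; push .r true

/-- The program that translates hypergraphs to constraints. -/
def edgeProg (w p : ℕ) : Cmd :=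
  readUnary (push .z true ;; push .o true) ;; whileNonempty .inp (edgeCmd w) ;; move .z .r ;;
    pinCmd p ;; push .out false ;; move .o .out

end Cmd

theorem does_emit {k : Stk} (hk : k = .r ∨ k = .o) (s : Store) (hr : s.r2 = []) :
    Does (emit k) s { s with out := unary (s.get k).length ++ s.out }
      (5 * (s.get k).length + 3) := by
  have key : ∀ (l : List Bool) (s : Store), s.get k = l →
      Does (loop k false (fun b => push .r2 b ;; push .out true)) s
        (({ s with out := List.replicate l.length true ++ s.out, r2 := l.reverse ++ s.r2 } :
          Store).set k []) (3 * l.length + 1) := by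
    intro l
    induction l with
    | nil =>
      intro s h
      refine Does.of_eq (.loop_nil h) ?_ (by simp)
      rcases hk with rfl | rfl <;> simp only [Store.get] at h <;> ext1 <;> simp [Store.set, h]
    | cons b l ih =>
      intro s h
      refine Does.of_eq (.loop_cons h rfl (.seq (.push _ _ _) (.push _ _ _)) (ih _ ?_)) ?_
        (by simp; omega)
      · rcases hk with rfl | rfl <;> rfl
      · rcases hk with rfl | rfl <;> simp [Store.set, Store.get, List.replicate_succ']
  refine Does.of_eq (.seq (.push _ _ _) (.seq (key (s.get k) _ ?_)
    (does_move ?_ (s.get k).reverse _ ?_))) ?_ ?_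
  · rcases hk with rfl | rfl <;> rfl
  · rcases hk with rfl | rfl <;> decide
  · rcases hk with rfl | rfl <;> simp [Store.set, Store.get, hr]
  · rcases hk with rfl | rfl <;> simp [Store.set, Store.get, hr, unary]
  · simp; omega

/-- The stack `r` counts the current position, and `a` starts with one mark per place in the scope.
Each true bit uses up one mark, so the `m` marks that remain count the fresh variables still
required. The number `M` only bounds the cost of writing a position. -/
theorem does_scanRow {M : ℕ} (rest R : List Bool) (v m : ℕ) (s : Store)
    (h : s.inp = R ++ rest) (hz : s.z.length = R.length) (hr : s.r = List.replicate v true)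
    (ha : s.a = List.replicate (R.count true + m) true) (hr2 : s.r2 = []) (hM : v + R.length ≤ M) :
    Does scanRow s
      { s with inp := rest, z := [], z2 := s.z.reverse ++ s.z2
               r := List.replicate (v + R.length) true, a := List.replicate m true
               out := (trueIdx v R).reverse.flatMap unary ++ s.out }
      (R.length * (5 * M + 10) + 1) := by
  induction R generalizing s v with
  | nil =>
    have hz' : s.z = [] := List.length_eq_zero_iff.1 hz
    refine Does.of_eq (.loop_nil hz') ?_ (by simp)
    ext1 <;> simp_all [trueIdx]
  | cons x R ih =>
    obtain ⟨b, z, hz'⟩ := List.exists_cons_of_length_eq_add_one hz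
    have hzl : z.length = R.length := by simpa [hz'] using hz
    simp only [List.length_cons] at hM
    cases x
    · refine Does.of_eq (.loop_cons hz' rfl (.seq (.push _ _ _) (.seq
        (.case_cons (b := false) h (.skip _)) (.push _ _ _)))
        (ih (v + 1) _ rfl hzl ?_ ?_ hr2 (by omega))) ?_ ?_
      · simp [Store.set, Store.get, hr, List.replicate_succ]
      · simpa [Store.set, Store.get] using ha
      · simp [Store.set, Store.get, trueIdx, hz', Nat.add_assoc, Nat.add_comm 1]
      · simp only [List.length_cons, Nat.add_mul]; omega
    · rw [List.count_cons_self, show R.count true + 1 + m = R.count true + m + 1 by omega,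
        List.replicate_succ] at ha
      refine Does.of_eq (.loop_cons hz' rfl (.seq (.push _ _ _) (.seq
        (.case_cons (b := true) h (.seq (does_emit (.inl rfl) _ hr2)
          (.case_cons (b := true) ha (.skip _)))) (.push _ _ _)))
        (ih (v + 1) _ rfl hzl ?_ rfl hr2 (by omega))) ?_ ?_
      · simp [Store.set, Store.get, hr, List.replicate_succ]
      · simp [Store.set, Store.get, trueIdx, hz', hr, Nat.add_assoc, Nat.add_comm 1]
      · simp only [List.length_cons, Nat.add_mul, Store.get, Store.set, hr, List.length_replicate]
        omega

theorem does_fillScope {M : ℕ} (m f : ℕ) (s : Store) (ha : s.a = List.replicate m true)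
    (ho : s.o = List.replicate f true) (hr : s.r2 = []) (hM : f + m ≤ M) :
    Does fillScope s
      { s with a := [], o := List.replicate (f + m) true, tmp := List.replicate m true ++ s.tmp
               out := (List.range' f m).reverse.flatMap unary ++ s.out }
      (m * (5 * M + 10) + 1) := by
  induction m generalizing s f with
  | zero => exact Does.of_eq (.loop_nil ha) (by ext1 <;> simp_all) (by simp)
  | succ m ih =>
    refine Does.of_eq (.loop_cons ha rfl (.seq (does_emit (.inr rfl) _ hr)
      (.seq (.push _ _ _) (.push _ _ _))) (ih (f + 1) _ rfl ?_ hr (by omega))) ?_ ?_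
    · simp [Store.set, Store.get, ho, List.replicate_succ]
    · simp [Store.set, Store.get, ho, List.range'_succ, List.replicate_succ', Nat.add_assoc,
        Nat.add_comm 1]
    · simp only [Nat.add_mul, Store.get, Store.set, ho, List.length_replicate]
      omega

theorem does_edgeCmd {M w n f : ℕ} {rest R : List Bool} {s : Store}
    (h : s.inp = R ++ rest) (hR : R.length = n) (hz : s.z = List.replicate n true)
    (hz2 : s.z2 = []) (hr : s.r = []) (hr2 : s.r2 = []) (ha : s.a = [])
    (ho : s.o = List.replicate f true) (hw : R.count true ≤ w) (hn : n ≤ M)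
    (hM : f + slack w R ≤ M) :
    Does (edgeCmd w) s
      { s with inp := rest, o := List.replicate (f + slack w R) true
               tmp := List.replicate (slack w R) true ++ s.tmp
               out := rawCode (0, (trueIdx 0 R ++ List.range' f (slack w R)).reverse) ++ s.out }
      ((n + w + 1) * (5 * M + 20)) := by
  have hsl : R.count true + slack w R = w := Nat.add_sub_cancel' hw
  refine Does.of_eq (.seq (does_pushList _ _ _) (.seq
    (does_scanRow rest R 0 (slack w R) _ h (by simp [Store.set, hz, hR]) hr ?_ hr2
      (M := M) (by omega)) (.seq (does_move (by decide) (List.replicate n true) _ ?_)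
    (.seq (does_clear _ (List.replicate n true) _ ?_)
    (.seq (does_fillScope (M := M) (slack w R) f _ ?_ ho ?_ hM) (.push _ _ _)))))) ?_ ?_
  · simp [Store.set, Store.get, ha, hsl]
  · simp [Store.set, Store.get, hz, hz2]
  · simp [Store.set, Store.get, hR]
  · simp [Store.set]
  · simp [Store.set, hr2]
  · simp [Store.set, Store.get, hz, hz2, ha, hr, rawCode, unary]
  · have h1 : slack w R * (5 * M + 10) ≤ w * (5 * M + 10) :=
      Nat.mul_le_mul_right _ (by omega)
    simp only [List.length_replicate, hR]
    nlinarith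

theorem totalSlack_cons (w : ℕ) (R : List Bool) (rows : List (List Bool)) :
    totalSlack w (R :: rows) = slack w R + totalSlack w rows := by simp [totalSlack]

/-- Throughout the loop `o` holds the next fresh variable and `tmp` one mark for every fresh
variable used so far, for later pinning. Positivity of `n` ensures that the input is non-empty while
rows remain. -/
theorem does_edgeLoop {M w n : ℕ} (hn0 : 0 < n) (rows : List (List Bool)) (f : ℕ) (s : Store)
    (h : s.inp = rows.flatten) (hR : ∀ R ∈ rows, R.length = n)
    (hw : ∀ R ∈ rows, R.count true ≤ w) (hz : s.z = List.replicate n true)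
    (hz2 : s.z2 = []) (hr : s.r = []) (hr2 : s.r2 = []) (ha : s.a = [])
    (ho : s.o = List.replicate f true) (hn : n ≤ M) (hM : f + totalSlack w rows ≤ M) :
    Does (whileNonempty .inp (edgeCmd w)) s
      { s with inp := [], o := List.replicate (f + totalSlack w rows) true
               tmp := List.replicate (totalSlack w rows) true ++ s.tmp
               out := (edgeRaws w f rows).reverse.flatMap rawCode ++ s.out }
      (rows.length * ((n + w + 1) * (5 * M + 20) + 2) + 1) := by
  induction rows generalizing s f with
  | nil =>
    refine Does.of_eq (.loop_nil h) ?_ (by simp)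
    ext1 <;> simp_all [totalSlack, edgeRaws]
  | cons R rows ih =>
    rw [totalSlack_cons] at hM
    have hRn := hR R (by simp)
    have hne : s.get .inp ≠ [] := by
      have : s.get .inp = R ++ rows.flatten := by simpa [Store.get] using h
      rw [this]
      intro h0
      simp only [List.append_eq_nil_iff] at h0
      simp [h0.1] at hRn
      omega
    refine Does.of_eq (does_while hne
      (does_edgeCmd (M := M) (rest := rows.flatten) (by simpa using h) hRn hz hz2 hr hr2 ha ho
        (hw R (by simp)) hn (by omega))
      (ih (f + slack w R) _ rfl (fun R hR' => hR R (by simp [hR'])) (fun R hR' => hw R (by simp [hR']))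
        hz hz2 hr hr2 ha rfl (by omega))) ?_ ?_
    · simp only [totalSlack_cons, edgeRaws, Nat.add_assoc, Nat.add_comm (slack w R)]
      simp [List.replicate_add, -List.replicate_append_replicate]
    · simp only [List.length_cons, Nat.add_mul]; omega

theorem does_pinCmd {M p : ℕ} (hp : p < 3) (m f : ℕ) (s : Store)
    (ht : s.tmp = List.replicate m true) (h : s.r = List.replicate f true) (hr : s.r2 = [])
    (hM : f + m ≤ M) :
    Does (pinCmd p) s
      { s with tmp := [], r := List.replicate (f + m) true
               out := (pinRaws p f m).reverse.flatMap rawCode ++ s.out }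
      (m * (5 * M + 10) + 1) := by
  induction m generalizing s f with
  | zero => exact Does.of_eq (.loop_nil ht) (by ext1 <;> simp_all [pinRaws]) (by simp)
  | succ m ih =>
    refine Does.of_eq (.loop_cons ht rfl (.seq (does_emit (.inl rfl) _ hr)
      (.seq (does_pushList _ _ _) (.push _ _ _))) (ih (f + 1) _ rfl ?_ hr (by omega))) ?_ ?_
    · simp [Store.set, Store.get, h, List.replicate_succ]
    · simp [Store.set, Store.get, h, List.range'_succ, pinRaws, rawCode, Nat.add_assoc,
        Nat.add_comm 1]
    · simp only [Nat.add_mul, Store.get, Store.set, h, List.length_replicate, List.length_reverse,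
        length_unary]
      omega

theorem does_readHeader (rest : List Bool) (v : ℕ) (s : Store) (h : s.inp = unary v ++ rest) :
    Does (readUnary (push .z true ;; push .o true)) s
      { s with inp := rest, z := List.replicate v true ++ s.z, o := List.replicate v true ++ s.o }
      (3 * v + 2) := by
  rw [unary_append] at h
  induction v generalizing s with
  | zero => exact Does.of_eq (.loop_exit h (.skip _)) (by ext1 <;> simp [Store.set]) (by simp)
  | succ v ih =>
    exact Does.of_eq (.loop_cons (b := true) h rfl (.seq (.push _ _ _) (.push _ _ _)) (ih _ rfl))
      (by simp [Store.set, Store.get, List.replicate_succ']) (by omega)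

/-- After the loop `z` still has length `n`, so moved to `r` it is the first fresh variable; `tmp`
says how many to pin, and `o` is the total number of variables for the header, which is pushed last
because it must be on top. -/
theorem does_edgeProg {M w n p : ℕ} (hp : p < 3) (hn0 : 0 < n) (rows : List (List Bool)) (k : ℕ)
    (hR : ∀ R ∈ rows, R.length = n) (hw : ∀ R ∈ rows, R.count true ≤ w)
    (hM : n + totalSlack w rows ≤ M) :
    ∃ s, Does (edgeProg w p) (initStore (unary n ++ rows.flatten) k) s
      (rows.length * ((n + w + 1) * (5 * M + 20) + 2) + totalSlack w rows * (5 * M + 10) +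
        7 * M + 10) ∧ s.inp = [] ∧ s.eps = List.replicate k true ∧ s.bad = [] ∧
      s.out = rawWord (n + totalSlack w rows)
        (edgeRaws w n rows ++ pinRaws p n (totalSlack w rows)).reverse := by
  refine ⟨_, Does.weaken (.seq (does_readHeader rows.flatten n _ rfl) (.seq
    (does_edgeLoop (M := M) hn0 rows n _ rfl hR hw (by simp [initStore]) rfl rfl rfl rfl
      (by simp [initStore]) (by omega) hM)
    (.seq (does_move (by decide) (List.replicate n true) _ (by simp [Store.get, initStore]))
    (.seq (does_pinCmd (M := M) hp (totalSlack w rows) n _ (by simp [Store.set, initStore])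
      (by simp [Store.set, Store.get, initStore]) rfl hM)
    (.seq (.push _ _ _) (does_move (by decide) (List.replicate (n + totalSlack w rows) true) _
      (by simp [Store.set, Store.get]))))))) ?_, rfl, rfl, rfl, ?_⟩
  · simp only [List.length_replicate]; omega
  · simp [Store.set, Store.get, initStore, rawWord, unary]

/-! ### Correctness of the padding of hyper-edges -/

theorem mem_trueIdx {v u : ℕ} {R : List Bool} :
    v ∈ trueIdx u R ↔ u ≤ v ∧ R.getD (v - u) false = true := by
  induction R generalizing u with
  | nil => simp [trueIdx]
  | cons b R ih =>
    have h : v ∈ trueIdx u (b :: R) ↔ (b = true ∧ v = u) ∨ v ∈ trueIdx (u + 1) R := by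
      cases b <;> simp [trueIdx]
    rw [h, ih]
    rcases lt_trichotomy v u with hv | rfl | hv
    · simp only [Nat.not_le.2 hv, false_and, iff_false]
      omega
    · simp
    · have : v - u = v - (u + 1) + 1 := by omega
      rw [this, List.getD_cons_succ]
      simp only [hv.ne', and_false, false_or, hv.le, true_and]
      exact ⟨fun h => h.2, fun h => ⟨hv, h⟩⟩

theorem mem_trueIdx_zero {v : ℕ} {R : List Bool} :
    v ∈ trueIdx 0 R ↔ R.getD v false = true := by simp [mem_trueIdx]

theorem nodup_trueIdx (u : ℕ) (R : List Bool) : (trueIdx u R).Nodup := by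
  induction R generalizing u with
  | nil => simp [trueIdx]
  | cons b R ih =>
    cases b
    · simpa [trueIdx] using ih (u + 1)
    · simp only [trueIdx, if_true, List.nodup_cons]
      exact ⟨fun h => by have := (mem_trueIdx.1 h).1; omega, ih _⟩

theorem length_trueIdx (u : ℕ) (R : List Bool) : (trueIdx u R).length = R.count true := by
  induction R generalizing u with
  | nil => simp [trueIdx]
  | cons b R ih => cases b <;> simp [trueIdx, ih]

theorem lt_of_getD {R : List Bool} {v : ℕ} (h : R.getD v false = true) : v < R.length := by
  by_contra hv
  rw [List.getD_eq_default _ _ (by omega)] at h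
  simp at h

theorem row_ext {R R' : List Bool} (hl : R.length = R'.length)
    (h : ∀ v, R.getD v false = true ↔ R'.getD v false = true) : R = R' := by
  refine List.ext_getElem hl fun i h1 h2 => ?_
  have := h i
  rw [List.getD_eq_getElem _ _ h1, List.getD_eq_getElem _ _ h2] at this
  exact Bool.eq_iff_iff.2 this

theorem true_mem_iff_getD {R : List Bool} : true ∈ R ↔ ∃ v, R.getD v false = true := by
  constructor
  · intro h
    obtain ⟨i, hi, h⟩ := List.getElem_of_mem h
    exact ⟨i, by rw [List.getD_eq_getElem _ _ hi, h]⟩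
  · rintro ⟨v, h⟩
    have hv := lt_of_getD h
    rw [List.getD_eq_getElem _ _ hv] at h
    exact h ▸ List.getElem_mem hv

theorem edgeRaws_fst {w f : ℕ} {rows : List (List Bool)} {c : ℕ × List ℕ}
    (hc : c ∈ edgeRaws w f rows) : c.1 = 0 := by
  induction rows generalizing f with
  | nil => simp [edgeRaws] at hc
  | cons R rows ih =>
    simp only [edgeRaws, List.mem_cons] at hc
    rcases hc with rfl | hc
    · rfl
    · exact ih hc

theorem edgeRaws_snd {w f n : ℕ} {rows : List (List Bool)} (hR : ∀ R ∈ rows, R.length = n)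
    (hw : ∀ R ∈ rows, R.count true ≤ w) {c : ℕ × List ℕ}
    (hc : c ∈ edgeRaws w f rows) : c.2.length = w ∧
      ∀ v ∈ c.2, v < n ∨ (f ≤ v ∧ v < f + totalSlack w rows) := by
  induction rows generalizing f with
  | nil => simp [edgeRaws] at hc
  | cons R rows ih =>
    simp only [edgeRaws, List.mem_cons] at hc
    rcases hc with rfl | hc
    · have h1 := hw R (by simp)
      refine ⟨by simp [length_trueIdx, slack]; omega, fun v hv => ?_⟩
      simp only [List.mem_reverse, List.mem_append, mem_trueIdx_zero, List.mem_range'_1] at hv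
      rw [totalSlack_cons]
      rcases hv with hv | hv
      · exact .inl (hR R (by simp) ▸ lt_of_getD hv)
      · exact .inr (by omega)
    · obtain ⟨h1, h2⟩ := ih (fun R h => hR R (by simp [h])) (fun R h => hw R (by simp [h])) hc
      refine ⟨h1, fun v hv => ?_⟩
      rw [totalSlack_cons]
      rcases h2 v hv with h | h
      · exact .inl h
      · exact .inr (by omega)

/-- Discarding the fresh variables, all of which are at least `n`, recovers the hyper-edge from the
scope; distinct hyper-edges therefore give distinct constraints. -/
theorem nodup_edgeRaws {w f n : ℕ} {rows : List (List Bool)} (hR : ∀ R ∈ rows, R.length = n)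
    (hnd : rows.Nodup) (hf : n ≤ f) : (edgeRaws w f rows).Nodup := by
  have key : ∀ (rows : List (List Bool)) (f : ℕ), (∀ R ∈ rows, R.length = n) → n ≤ f →
      (edgeRaws w f rows).map (fun c => c.2.reverse.filter (· < n)) = rows.map (trueIdx 0) := by
    intro rows
    induction rows with
    | nil => intros; rfl
    | cons R rows ih =>
      intro f hR hf
      simp only [edgeRaws, List.map_cons, List.reverse_reverse, List.filter_append]
      rw [ih _ (fun R h => hR R (by simp [h])) (by omega)]
      congr 1
      rw [List.filter_eq_self.2, List.filter_eq_nil_iff.2, List.append_nil]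
      · intro v hv
        rw [List.mem_range'_1] at hv
        simp; omega
      · intro v hv
        have := lt_of_getD (mem_trueIdx_zero.1 hv)
        simpa [hR R (by simp)] using this
  refine List.Nodup.of_map _ (key rows f hR hf ▸ List.Nodup.map_on ?_ hnd)
  intro R h R' h' he
  refine row_ext ((hR R h).trans (hR R' h').symm) fun v => ?_
  rw [← mem_trueIdx_zero, ← mem_trueIdx_zero, he]

/-- The blocks of fresh variables of successive hyper-edges are adjacent intervals, so each fresh
variable is used exactly once, while an old vertex occurs once for each hyper-edge containing it. -/
theorem sum_count_edgeRaws {w f n : ℕ} {rows : List (List Bool)}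
    (hR : ∀ R ∈ rows, R.length = n) (hf : n ≤ f) (v : ℕ) :
    ((edgeRaws w f rows).map fun c => c.2.count v).sum =
      rows.countP (fun R => R.getD v false) +
        if f ≤ v ∧ v < f + totalSlack w rows then 1 else 0 := by
  induction rows generalizing f with
  | nil => simp [edgeRaws, totalSlack]
  | cons R rows ih =>
    simp only [edgeRaws, List.map_cons, List.sum_cons, List.count_reverse, List.count_append]
    rw [ih (fun R h => hR R (by simp [h])) (by omega), List.countP_cons,
      (nodup_trueIdx 0 R).count, (List.nodup_range' (step := 1)).count, totalSlack_cons]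
    simp only [mem_trueIdx_zero, List.mem_range'_1]
    have : (if f ≤ v ∧ v < f + slack w R then 1 else 0) +
        (if f + slack w R ≤ v ∧ v < f + slack w R + totalSlack w rows then 1 else 0) =
        if f ≤ v ∧ v < f + (slack w R + totalSlack w rows) then 1 else 0 := by
      split_ifs <;> omega
    omega

theorem sum_count_pinRaws (p f m v : ℕ) :
    ((pinRaws p f m).map fun c => c.2.count v).sum = if f ≤ v ∧ v < f + m then 1 else 0 := by
  induction m generalizing f with
  | zero => simp [pinRaws]
  | succ m ih =>
    have := ih (f + 1)
    simp only [pinRaws, List.map_map] at this ⊢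
    rw [List.range'_succ, List.map_cons, List.sum_cons, this]
    simp only [Function.comp, List.count_singleton, beq_iff_eq]
    split_ifs <;> omega

theorem RawHypergraph.rawCSP {d w n p : ℕ} {rows : List (List Bool)}
    (h : RawHypergraph d w n rows) (hd : 2 ≤ d) (hp : p = 1 ∨ p = 2) :
    RawCSP d w (n + totalSlack w rows)
      (edgeRaws w n rows ++ pinRaws p n (totalSlack w rows)).reverse where
  nodup := by
    rw [List.nodup_reverse, List.nodup_append']
    refine ⟨nodup_edgeRaws h.len h.nodup le_rfl, ?_, ?_⟩
    · exact (List.nodup_range' (step := 1)).map fun a b hab => by simpa using hab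
    · intro c hc hc'
      simp only [pinRaws, List.mem_map] at hc'
      obtain ⟨v, -, rfl⟩ := hc'
      have : p = 0 := edgeRaws_fst hc
      omega
  idx := by
    intro c hc
    simp only [List.mem_reverse, List.mem_append, pinRaws, List.mem_map] at hc
    rcases hc with hc | ⟨v, -, rfl⟩
    · simp [edgeRaws_fst hc]
    · rcases hp with rfl | rfl <;> simp
  len := by
    intro c hc
    simp only [List.mem_reverse, List.mem_append, pinRaws, List.mem_map] at hc
    rcases hc with hc | ⟨v, -, rfl⟩
    · rw [if_pos (edgeRaws_fst hc), (edgeRaws_snd h.len h.le hc).1]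
    · rcases hp with rfl | rfl <;> simp
  lt := by
    intro c hc v hv
    simp only [List.mem_reverse, List.mem_append, pinRaws, List.mem_map] at hc
    rcases hc with hc | ⟨u, hu, rfl⟩
    · have := (edgeRaws_snd h.len h.le hc).2 v hv
      omega
    · simp only [List.mem_singleton] at hv
      rw [List.mem_range'_1] at hu
      omega
  deg v := by
    rw [List.map_reverse, List.sum_reverse, List.map_append, List.sum_append,
      sum_count_edgeRaws h.len le_rfl, sum_count_pinRaws]
    have h1 := h.deg v
    split_ifs with hv
    -- A fresh variable lies in no hyper-edge; it occurs once as padding and once in its pin, hence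
    -- twice.
    · have : rows.countP (fun R => R.getD v false) = 0 := by
        refine List.countP_eq_zero.2 fun R hR hv' => ?_
        have h2 := lt_of_getD hv'
        have h3 := h.len R hR
        omega
      omega
    · omega

theorem edgeRaws_sat {w f p : ℕ} {rows : List (List Bool)} {S : Finset ℕ}
    (hS : ∀ v, f ≤ v → v < f + totalSlack w rows → v ∈ S) :
    (∀ c ∈ edgeRaws w f rows, RawSat p S c) ↔
      ∀ R ∈ rows, ∃ v, R.getD v false = true ∧ v ∉ S := by
  induction rows generalizing f with
  | nil => simp [edgeRaws]
  | cons R rows ih =>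
    rw [totalSlack_cons] at hS
    simp only [edgeRaws, List.forall_mem_cons]
    refine and_congr ?_ (ih fun v h1 h2 => hS v (by omega) (by omega))
    simp only [RawSat, if_true, List.mem_reverse, List.mem_append, mem_trueIdx_zero,
      List.mem_range'_1]
    constructor
    · rintro ⟨v, hv | hv, hS'⟩
      · exact ⟨v, hv, hS'⟩
      · exact absurd (hS v hv.1 (by omega)) hS'
    · rintro ⟨v, hv, hS'⟩
      exact ⟨v, .inl hv, hS'⟩

/-- The pins force all fresh variables into `S`, and then the padding cannot witness that a scope
escapes `S`. Restriction to the numbers below `n` is inverse to adjoining the interval of fresh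
variables. -/
theorem rawCount_edgeRaws {w n p : ℕ} {rows : List (List Bool)}
    (hR : ∀ R ∈ rows, R.length = n) (hp : p = 1 ∨ p = 2) :
    rawCount p (n + totalSlack w rows)
      (edgeRaws w n rows ++ pinRaws p n (totalSlack w rows)).reverse = rowCount n rows := by
  set F := totalSlack w rows with hF
  have hpins : ∀ S : Finset ℕ, (∀ c ∈ pinRaws p n F, RawSat p S c) ↔
      ∀ v, n ≤ v → v < n + F → v ∈ S := by
    intro S
    have hv : ∀ v, RawSat p S (p, [v]) ↔ v ∈ S := by
      rcases hp with rfl | rfl <;> simp [RawSat]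
    simp only [pinRaws, List.forall_mem_map, List.mem_range'_1, hv, and_imp]
  have hsat : ∀ S : Finset ℕ, (∀ c ∈ (edgeRaws w n rows ++ pinRaws p n F).reverse, RawSat p S c) ↔
      (∀ v, n ≤ v → v < n + F → v ∈ S) ∧ ∀ R ∈ rows, ∃ v, R.getD v false = true ∧ v ∉ S := by
    intro S
    simp only [List.mem_reverse, List.forall_mem_append, hpins]
    exact ⟨fun h => ⟨h.2, (edgeRaws_sat h.2).1 h.1⟩, fun h => ⟨(edgeRaws_sat h.1).2 h.2, h.1⟩⟩
  simp only [rawCount, hsat, rowCount]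
  refine Nat.card_congr
    { toFun := fun S => ⟨S.1.filter (· < n), fun v hv => by simp at hv ⊢; exact hv.2,
        fun R h => ?_⟩
      invFun := fun S => ⟨S.1 ∪ Finset.Ico n (n + F), fun v hv => ?_, fun v h1 h2 => by simp [h1, h2],
        fun R h => ?_⟩
      left_inv := fun S => ?_
      right_inv := fun S => ?_ }
  · obtain ⟨v, hv, hvS⟩ := S.2.2.2 R h
    exact ⟨v, hv, fun hm => hvS (Finset.mem_filter.1 hm).1⟩
  · simp only [Finset.mem_union, Finset.mem_Ico, Finset.mem_range] at hv ⊢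
    rcases hv with hv | hv
    · have := Finset.mem_range.1 (S.2.1 hv)
      omega
    · exact hv.2
  · obtain ⟨v, hv, hvS⟩ := S.2.2 R h
    have := lt_of_getD hv
    have := hR R h
    exact ⟨v, hv, by simp [hvS]; omega⟩
  · ext v
    simp only [Finset.mem_union, Finset.mem_filter, Finset.mem_Ico]
    constructor
    · rintro (h | h)
      · exact h.1
      · exact S.2.2.1 v h.1 h.2
    · intro h
      have := Finset.mem_range.1 (S.2.1 h)
      by_cases hv : v < n
      · exact .inl ⟨h, hv⟩
      · exact .inr (by omega)
  · ext v
    simp only [Finset.mem_union, Finset.mem_filter, Finset.mem_Ico]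
    constructor
    · rintro ⟨h | h, hv⟩
      · exact h
      · omega
    · intro h
      exact ⟨.inl h, Finset.mem_range.1 (S.2.1 h)⟩

theorem totalSlack_le (w : ℕ) (rows : List (List Bool)) : totalSlack w rows ≤ rows.length * w := by
  have := List.sum_le_card_nsmul (rows.map (slack w)) w (by
    intro x hx
    obtain ⟨R, -, rfl⟩ := List.mem_map.1 hx
    exact Nat.sub_le _ _)
  simpa [totalSlack] using this

theorem length_flatten_of_forall {n : ℕ} {rows : List (List Bool)}
    (h : ∀ R ∈ rows, R.length = n) : rows.flatten.length = rows.length * n := by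
  rw [List.length_flatten, List.sum_eq_card_nsmul _ n (by simpa using h)]
  simp

theorem edgeProg_time {X w m n t : ℕ} (hX : 2 ≤ X) (hw : 2 ≤ w) (hn : n ≤ X) (hm : m ≤ X)
    (ht : t ≤ X * (w + 1)) :
    m * ((n + w + 1) * (5 * (X * (w + 1)) + 20) + 2) + t * (5 * (X * (w + 1)) + 10) +
      7 * (X * (w + 1)) + 10 ≤ 200 * (w + 1) ^ 2 * X ^ 3 := by
  obtain ⟨W, hW⟩ : ∃ W, W = w + 1 := ⟨_, rfl⟩
  -- Everything is measured against `Y = X * W`, which is at least 6 and so absorbs the additive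
  -- constants.
  have a1 : n + w + 1 ≤ 2 * (X * W) := by nlinarith
  rw [← hW] at ht ⊢
  have hXW : 6 ≤ X * W := Nat.mul_le_mul hX (by omega : 3 ≤ W)
  have a6 : (X * W) ^ 2 ≤ X * (X * W) ^ 2 := Nat.le_mul_of_pos_left _ (by omega)
  have a8 : 200 * W ^ 2 * X ^ 3 = 200 * (X * (X * W) ^ 2) := by ring
  generalize hY : X * W = Y at *
  have a3 : (n + w + 1) * (5 * Y + 20) + 2 ≤ 21 * Y ^ 2 := by
    have := Nat.mul_le_mul a1 (by omega : 5 * Y + 20 ≤ 10 * Y)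
    nlinarith
  have a4 := Nat.mul_le_mul hm a3
  have a5 : t * (5 * Y + 10) ≤ Y * (10 * Y) := Nat.mul_le_mul ht (by omega)
  have a7 : Y ≤ Y ^ 2 := Nat.le_self_pow (by norm_num) _
  rw [a8]
  nlinarith

theorem apReducible_countHIS_countCSP (β : Bool) {d w : ℕ} (hd : 2 ≤ d) (hw : 2 ≤ w) :
    APReducible (countHIS w d) (countCSP d (lang β w)) := by
  have hp : pinIdx β = 1 ∨ pinIdx β = 2 := by cases β <;> simp [pinIdx]
  refine apReducible_of_does (edgeProg w (pinIdx β)) (200 * (w + 1) ^ 2) 1 fun I x hx k => ?_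
  obtain ⟨n, rows, h, rfl, hcount⟩ := exists_rows_of_encodes (by omega) hx
  have hn : 0 < n := by
    obtain ⟨R, hR, hc⟩ := h.ex
    rw [← h.len R hR]
    have : R.count true ≤ R.length := List.count_le_length
    omega
  obtain ⟨J, hJ, hJc⟩ := exists_encodes_of_raw β (h.rawCSP hd hp)
  set X := (unary n ++ rows.flatten).length + 1 with hX
  have hlen : X = n + rows.length * n + 2 := by
    simp [hX, -List.length_flatten, length_flatten_of_forall h.len]; omega
  -- Each row contributes `n ≥ 1` bits to the word, so there are at most as many rows as bits.
  have hm : rows.length ≤ X := by nlinarith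
  have hs := totalSlack_le w rows
  have hM : n + totalSlack w rows ≤ X * (w + 1) := by nlinarith
  obtain ⟨s, hs, h1, h2, h3, h4⟩ := does_edgeProg (M := X * (w + 1)) (p := pinIdx β) (by omega) hn
    rows k h.len h.le hM
  refine ⟨s, hs.weaken ?_, h1, .inr ⟨h3, by simp [h2], J, h4 ▸ hJ, ?_⟩⟩
  · exact edgeProg_time (by omega) hw (by omega) hm (by nlinarith)
  · rw [hJc, hcount, rawCount_edgeRaws h.len hp]

/-! ### From constraints to hypergraphs -/

/-- The characteristic vector of length `N` of the elements of a list. -/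
def rowOf (N : ℕ) (l : List ℕ) : List Bool := (List.range N).map fun v => decide (v ∈ l)

/-- Insert several elements into a list, without repetition. -/
def insertAll (rows L : List (List Bool)) : List (List Bool) :=
  L.foldl (fun acc R => acc.insert R) rows

/-- The scopes of the constraints whose relation has the position `p`. -/
def pinned (p : ℕ) (raws : List (ℕ × List ℕ)) : List (List ℕ) :=
  (raws.filter fun c => c.1 = p).map Prod.snd

/-- The scopes of the constraints whose relation does not have the position `p`. -/
def unpinned (p : ℕ) (raws : List (ℕ × List ℕ)) : List (List ℕ) :=
  (raws.filter fun c => c.1 ≠ p).map Prod.snd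

/-- A hypergraph on `w` vertices that has only one independent set: the hyper-edge that contains
all vertices, and all hyper-edges of size one. -/
def gadget (w : ℕ) : List (List ℕ) := List.range w :: (List.range w).map fun i => [i]

namespace Cmd

/-- Put the gadget, on additional vertices, into the list of rows `a`. -/
def gadgetCmd (w : ℕ) : List (List ℕ) → Cmd
  | [] => skip
  | l :: ls => (fill .a ;; pushList .a (rowOf w l)) ;; gadgetCmd w ls

/-- Treat a constraint with a scope of length `m` that forbids that all its variables are in the
set. -/
def edgeConstraint (m : ℕ) : Cmd := fill .r ;; rep m setBit ;; move .r .a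

/-- Treat a constraint that pins a variable to be in the set. -/
def pinConstraint : Cmd := fill .r ;; setBit ;; zip (fun x _ => x) (fun x y => x || y) ;; insertRow

/-- Take a row from the list `a`. -/
def readRow : Cmd :=
  loop .z false (fun b => push .z2 b ;; case .a (fun x => push .r x) skip) ;; move .z2 .z

/-- Take a row from the list `a`, remove the pinned vertices, and put it into the list `out`. -/
def reduceRow : Cmd :=
  readRow ;; zip (fun x y => x && !y) (fun _ y => y) ;; test ;; insertRow

/-- The program that translates constraints to hypergraphs. -/
def hypergraphProg (w p : ℕ) : Cmd :=
  readUnary (push .z true) ;; gadgetCmd w (gadget w) ;; pushList .z (List.replicate w true) ;;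
    fill .o ;; dispatch (fun i => if i = p then pinConstraint else
      edgeConstraint (if i = 0 then w else 1)) ;;
    whileNonempty .a reduceRow ;; push .out false ;; move .z .out

end Cmd

/-! ### Characteristic vectors of lists, and the running time of the translation to hypergraphs -/

@[simp] theorem length_rowOf (N : ℕ) (l : List ℕ) : (rowOf N l).length = N := by simp [rowOf]

theorem getD_rowOf {N : ℕ} {l : List ℕ} {v : ℕ} :
    (rowOf N l).getD v false = true ↔ v < N ∧ v ∈ l := by
  by_cases h : v < N <;> simp [rowOf, List.getD_eq_getElem?_getD, h]

theorem rowOf_congr {N : ℕ} {l l' : List ℕ} (h : ∀ v < N, v ∈ l ↔ v ∈ l') :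
    rowOf N l = rowOf N l' :=
  List.map_congr_left fun v hv => by simp [h v (List.mem_range.1 hv)]

theorem rowOf_nil (N : ℕ) : rowOf N [] = List.replicate N false := by
  simp [rowOf]

theorem rowOf_cons (N v : ℕ) (l : List ℕ) : rowOf N (v :: l) = (rowOf N l).set v true := by
  refine List.ext_getElem (by simp) fun i h1 h2 => ?_
  rw [List.getElem_set]
  simp only [rowOf, List.getElem_map, List.getElem_range, List.mem_cons]
  split_ifs with h
  · simp [h]
  · simp [show ¬ i = v from fun h' => h h'.symm]

theorem zipWith_rowOf_or (N : ℕ) (l l' : List ℕ) :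
    List.zipWith (fun x y => x || y) (rowOf N l) (rowOf N l') = rowOf N (l' ++ l) := by
  rw [rowOf, rowOf, List.zipWith_map_left, List.zipWith_map_right, List.zipWith_self]
  refine List.map_congr_left fun v _ => ?_
  simp [or_comm]

theorem zipWith_rowOf_diff (N : ℕ) (l l' : List ℕ) :
    List.zipWith (fun x y => x && !y) (rowOf N l) (rowOf N l') =
      rowOf N (l.filter fun v => v ∉ l') := by
  rw [rowOf, rowOf, List.zipWith_map_left, List.zipWith_map_right, List.zipWith_self]
  refine List.map_congr_left fun v _ => ?_
  simp

theorem zipWith_rowOf_fst (N : ℕ) (l l' : List ℕ) :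
    List.zipWith (fun x _ => x) (rowOf N l) (rowOf N l') = rowOf N l := by
  rw [rowOf, rowOf, List.zipWith_map_left, List.zipWith_map_right, List.zipWith_self]

theorem zipWith_rowOf_snd (N : ℕ) (l l' : List ℕ) :
    List.zipWith (fun _ y => y) (rowOf N l) (rowOf N l') = rowOf N l' := by
  rw [rowOf, rowOf, List.zipWith_map_left, List.zipWith_map_right, List.zipWith_self]

theorem replicate_append_rowOf (n w : ℕ) (l : List ℕ) :
    List.replicate n false ++ rowOf w l = rowOf (n + w) (l.map (n + ·)) := by
  rw [rowOf, rowOf, List.range_add, List.map_append, List.map_map]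
  congr 1
  · symm
    rw [List.map_eq_replicate_iff.2, List.length_range]
    intro v hv
    simp only [List.mem_range] at hv
    simp only [List.mem_map, decide_eq_false_iff_not]
    rintro ⟨u, -, hu⟩
    omega
  · exact List.map_congr_left fun v _ => by simp

theorem mem_insertAll {rows L : List (List Bool)} {R : List Bool} :
    R ∈ insertAll rows L ↔ R ∈ rows ∨ R ∈ L := by
  induction L generalizing rows with
  | nil => simp [insertAll]
  | cons R' L ih =>
    have : insertAll rows (R' :: L) = insertAll (rows.insert R') L := rfl
    rw [this, ih, List.mem_insert_iff, List.mem_cons]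
    tauto

theorem nodup_insertAll {rows L : List (List Bool)} (h : rows.Nodup) :
    (insertAll rows L).Nodup := by
  induction L generalizing rows with
  | nil => exact h
  | cons R' L ih => exact ih h.insert

theorem length_insert_le (rows : List (List Bool)) (R : List Bool) :
    (rows.insert R).length ≤ rows.length + 1 := by
  rw [List.length_insert]; split_ifs <;> omega

theorem length_insertAll_le (rows L : List (List Bool)) :
    (insertAll rows L).length ≤ rows.length + L.length := by
  induction L generalizing rows with
  | nil => simp [insertAll]
  | cons R' L ih =>
    refine (ih (rows.insert R')).trans ?_
    have := length_insert_le rows R'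
    simp only [List.length_cons]
    omega

/-- At this point `z` has length `n`, so filling with `n` zeros shifts the gadget behind the
original variables. Rows lie reversed on `a`, so that popping them onto `r` later restores their
orientation. -/
theorem does_gadgetCmd {w : ℕ} (ls : List (List ℕ)) (s : Store) (hz2 : s.z2 = []) :
    Does (gadgetCmd w ls) s
      { s with a := (ls.map fun l =>
          rowOf (s.z.length + w) (l.map (s.z.length + ·))).flatten.reverse ++ s.a }
      (ls.length * (5 * s.z.length + w + 3) + 1) := by
  induction ls generalizing s with
  | nil => exact Does.of_eq (.skip _) (by simp) (by simp)
  | cons l ls ih =>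
    refine Does.of_eq (.seq (.seq (does_fill (.inl rfl) _ hz2) (does_pushList _ _ _))
      (ih _ hz2)) ?_ ?_
    · simp [Store.set, Store.get, ← replicate_append_rowOf]
    · simp only [List.length_cons, Nat.add_mul, Store.set, length_rowOf]; omega

theorem does_rep_setBit {N : ℕ} (l l₀ : List ℕ) (rest : List Bool) (s : Store)
    (h : s.inp = l.flatMap unary ++ rest) (hr : s.r = rowOf N l₀) (hlt : ∀ v ∈ l, v < N)
    (hr2 : s.r2 = []) :
    Does (rep l.length setBit) s { s with inp := rest, r := rowOf N (l.reverse ++ l₀) }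
      (l.length * (5 * N + 5) + 1) := by
  induction l generalizing s l₀ with
  | nil => exact Does.of_eq (.skip _) (by ext1 <;> simp_all) (by simp)
  | cons v l ih =>
    simp only [List.flatMap_cons, List.append_assoc] at h
    refine Does.of_eq (.seq (does_setBit h (by rw [hr]; simpa using hlt v (by simp)) hr2)
      (ih (v :: l₀) _ rfl ?_ (fun v hv => hlt v (by simp [hv])) hr2)) ?_ ?_
    · simp [hr, rowOf_cons]
    · simp
    · simp only [List.length_cons, Nat.add_mul, hr, length_rowOf]; omega

/-- The row is only stored on `a`: deleting pinned vertices must wait until all constraints have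
been read. A variable repeated in the scope sets the same bit again. -/
theorem does_edgeConstraint {N : ℕ} {l : List ℕ} {rest : List Bool} {s : Store}
    (h : s.inp = l.flatMap unary ++ rest) (hz : s.z = List.replicate N true) (hr : s.r = [])
    (hr2 : s.r2 = []) (hz2 : s.z2 = []) (hlt : ∀ v ∈ l, v < N) :
    Does (edgeConstraint l.length) s { s with inp := rest, a := (rowOf N l).reverse ++ s.a }
      (l.length * (5 * N + 5) + 7 * N + 4) := by
  refine Does.of_eq (.seq (does_fill (.inr (.inr rfl)) _ hz2) (.seq
    (does_rep_setBit (N := N) l [] rest _ h ?_ hlt hr2)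
    (does_move (by decide) (rowOf N (l.reverse ++ [])) _ rfl))) ?_ ?_
  · simp [Store.set, Store.get, hz, hr, rowOf_nil]
  · have : rowOf N (l.reverse ++ []) = rowOf N l := rowOf_congr fun v _ => by simp
    rw [this]
    simp [Store.set, Store.get, hr]
  · simp only [hz, List.length_replicate, length_rowOf]; omega

/-- The vertex is recorded in the mask `o`, for deletion from the other scopes, and its singleton
goes to the output at once, since it must not be affected by that deletion. -/
theorem does_pinConstraint {N v : ℕ} {ones : List ℕ} {rows : List (List Bool)} {rest : List Bool}
    {s : Store} (hN : 0 < N) (hrows : ∀ R ∈ rows, R.length = N) (h : s.inp = unary v ++ rest)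
    (hz : s.z = List.replicate N true) (hr : s.r = []) (hr2 : s.r2 = []) (hz2 : s.z2 = [])
    (ho : s.o = rowOf N ones) (ho2 : s.o2 = []) (ht : s.tmp = []) (hout : s.out = rows.flatten)
    (hv : v < N) :
    Does pinConstraint s
      { s with inp := rest, o := rowOf N (ones ++ [v]), out := (rows.insert (rowOf N [v])).flatten }
      (18 * N + 10 + (rows.length + 1) * (11 * N + 8)) := by
  have h0 : List.replicate s.z.length false ++ s.r = rowOf N [] := by simp [hz, hr, rowOf_nil]
  have h1 := does_fill (.inr (.inr rfl)) s hz2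
  simp only [Store.get, Store.set] at h1
  rw [h0] at h1
  have h2 := does_setBit (s := { s with r := rowOf N [] }) h (by simpa using hv) hr2
  simp only [← rowOf_cons] at h2
  have h3 := does_zip (fun x _ => x) (fun x y => x || y)
    (s := { s with inp := rest, r := rowOf N [v] }) (by simp [ho]) hr2 ho2
  simp only [ho, zipWith_rowOf_fst, zipWith_rowOf_or] at h3
  rw [← ho] at h3
  have h4 := does_insertRow hN hrows
    (s := { s with inp := rest, r := rowOf N [v], o := rowOf N (ones ++ [v]) })
    (by simp) hout hr2 ho2 hz2 ht
  refine Does.of_eq (.seq h1 (.seq h2 (.seq h3 h4))) (by simp [hr]) ?_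
  simp only [hz, List.length_replicate, length_rowOf]
  omega

theorem does_readRow {N : ℕ} {R rest : List Bool} {s : Store} (h : s.a = R.reverse ++ rest)
    (hR : R.length = N) (hz : s.z.length = N) (hr : s.r = []) (hz2 : s.z2 = []) :
    Does readRow s { s with a := rest, r := R } (6 * N + 2) := by
  have key : ∀ (L : List Bool) (s : Store), s.a = L ++ rest → s.z.length = L.length →
      Does (loop .z false (fun b => push .z2 b ;; case .a (fun x => push .r x) skip)) s
        { s with a := rest, z := [], z2 := s.z.reverse ++ s.z2, r := L.reverse ++ s.r }
        (4 * L.length + 1) := by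
    intro L
    induction L with
    | nil =>
      intro s h hz
      have hz' : s.z = [] := List.length_eq_zero_iff.1 hz
      exact Does.of_eq (.loop_nil hz') (by ext1 <;> simp_all) (by simp)
    | cons x L ih =>
      intro s h hz
      obtain ⟨b, z, hz'⟩ := List.exists_cons_of_length_eq_add_one hz
      refine Does.of_eq (.loop_cons hz' rfl (.seq (.push _ _ _) (.case_cons h (.push _ _ _)))
        (ih _ rfl (by simpa [hz', Store.set] using hz))) ?_ (by simp; omega)
      simp [Store.set, Store.get, hz']
  refine Does.of_eq (.seq (key R.reverse s h (by simp [hz, hR]))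
    (does_move (by decide) s.z.reverse _ ?_)) ?_ ?_
  · simp [Store.get, hz2]
  · simp [Store.set, Store.get, hr, hz2]
  · simp only [List.length_reverse, hR, hz]; omega

/-- Deletion can make scopes empty or equal. An empty row raises `bad`, because it is not a
legitimate hyper-edge; equal rows are merged on insertion, because the hyper-edges form a set. -/
theorem does_reduceRow {N : ℕ} {ones l : List ℕ} {rows : List (List Bool)} {rest : List Bool}
    {s : Store} (hN : 0 < N) (hrows : ∀ R ∈ rows, R.length = N)
    (h : s.a = (rowOf N l).reverse ++ rest)
    (hz : s.z.length = N) (hr : s.r = []) (hr2 : s.r2 = []) (hz2 : s.z2 = [])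
    (ho : s.o = rowOf N ones) (ho2 : s.o2 = []) (ht : s.tmp = []) (hout : s.out = rows.flatten) :
    Does reduceRow s
      { s with a := rest
               out := (rows.insert (rowOf N (l.filter fun v => v ∉ ones))).flatten
               bad := if true ∈ rowOf N (l.filter fun v => v ∉ ones) then s.bad
                 else true :: s.bad }
      (21 * N + 10 + (rows.length + 1) * (11 * N + 8)) := by
  have h1 := does_readRow h (by simp) hz hr hz2
  have h2 := does_zip (fun x y => x && !y) (fun _ y => y)
    (s := { s with a := rest, r := rowOf N l }) (by simp [ho]) hr2 ho2
  simp only [ho, zipWith_rowOf_diff, zipWith_rowOf_snd] at h2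
  rw [← ho] at h2
  have h3 := does_test (s := { s with
    a := rest, r := rowOf N (l.filter fun v => v ∉ ones) }) hr2 hz2
  have h4 := does_insertRow hN hrows (s := { s with
    a := rest, r := rowOf N (l.filter fun v => v ∉ ones)
    bad := if true ∈ rowOf N (l.filter fun v => v ∉ ones) then s.bad else true :: s.bad })
    (by simp) hout hr2 ho2 hz2 ht
  refine Does.of_eq (.seq h1 (.seq h2 (.seq h3 h4))) (by simp [hr]) ?_
  simp only [length_rowOf]
  omega

theorem forall_mem_insert_length {N : ℕ} {rows : List (List Bool)} {R : List Bool}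
    (h : ∀ R ∈ rows, R.length = N) (hR : R.length = N) : ∀ R' ∈ rows.insert R, R'.length = N := by
  intro R' hR'
  rcases List.mem_insert_iff.1 hR' with rfl | hR'
  · exact hR
  · exact h R' hR'

theorem does_reduceRows {N Q : ℕ} {ones : List ℕ} (hN : 0 < N) (ls : List (List ℕ))
    (rows : List (List Bool)) (s : Store) (hrows : ∀ R ∈ rows, R.length = N)
    (h : s.a = (ls.map fun l => (rowOf N l).reverse).flatten)
    (hz : s.z.length = N) (hr : s.r = []) (hr2 : s.r2 = []) (hz2 : s.z2 = [])
    (ho : s.o = rowOf N ones) (ho2 : s.o2 = []) (ht : s.tmp = []) (hout : s.out = rows.flatten)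
    (hQ : rows.length + ls.length ≤ Q) :
    ∃ bad, (bad = [] ↔ s.bad = [] ∧ ∀ l ∈ ls, true ∈ rowOf N (l.filter fun v => v ∉ ones)) ∧
      Does (whileNonempty .a reduceRow) s
        { s with a := [], bad := bad, out := (insertAll rows (ls.map fun l =>
            rowOf N (l.filter fun v => v ∉ ones))).flatten }
        (ls.length * (21 * N + 12 + (Q + 1) * (11 * N + 8)) + 1) := by
  induction ls generalizing s rows with
  | nil =>
    exact ⟨s.bad, by simp, Does.of_eq (.loop_nil h) (by ext1 <;> simp_all [insertAll]) (by simp)⟩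
  | cons l ls ih =>
    have ha : s.a = (rowOf N l).reverse ++ (ls.map fun l => (rowOf N l).reverse).flatten := by
      simpa using h
    have hne : s.get .a ≠ [] := by
      intro h0
      have h1 := congrArg List.length (ha.symm.trans h0)
      simp at h1
      omega
    have hlen := length_insert_le rows (rowOf N (l.filter fun v => v ∉ ones))
    simp only [List.length_cons] at hQ
    obtain ⟨bad, hbad, hD⟩ := ih (rows.insert (rowOf N (l.filter fun v => v ∉ ones)))
      { s with a := (ls.map fun l => (rowOf N l).reverse).flatten
               out := (rows.insert (rowOf N (l.filter fun v => v ∉ ones))).flatten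
               bad := if true ∈ rowOf N (l.filter fun v => v ∉ ones) then s.bad
                 else true :: s.bad }
      (forall_mem_insert_length hrows (by simp)) rfl hz hr hr2 hz2 ho ho2 ht rfl (by omega)
    refine ⟨bad, ?_, Does.of_eq (does_while hne
      (does_reduceRow hN hrows ha hz hr hr2 hz2 ho ho2 ht hout) hD) (by simp [insertAll]) ?_⟩
    · rw [hbad, List.forall_mem_cons]
      simp only
      split_ifs with hc
      · exact ⟨fun h => ⟨h.1, hc, h.2⟩, fun h => ⟨h.1, h.2.2⟩⟩
      · exact ⟨fun h => absurd h.1 (by simp), fun h => absurd h.2.1 hc⟩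
    · have := Nat.mul_le_mul_right (11 * N + 8) (by omega : rows.length + 1 ≤ Q + 1)
      simp only [List.length_cons, Nat.add_mul] at this ⊢
      omega

theorem does_dispatch_hypergraph {N Q w p : ℕ} (hN : 0 < N) (hp : p ≠ 0)
    (raws : List (ℕ × List ℕ)) (hidx : ∀ c ∈ raws, c.1 < 3)
    (hlen : ∀ c ∈ raws, c.2.length = if c.1 = 0 then w else 1)
    (hlt : ∀ c ∈ raws, ∀ v ∈ c.2, v < N) (ones : List ℕ) (ls : List (List ℕ))
    (rows : List (List Bool)) (s : Store) (hrows : ∀ R ∈ rows, R.length = N)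
    (h : s.inp = raws.flatMap rawCode) (hz : s.z = List.replicate N true)
    (ha : s.a = (ls.map (rowOf N)).flatten.reverse) (hr : s.r = []) (hr2 : s.r2 = [])
    (hz2 : s.z2 = []) (ho : s.o = rowOf N ones) (ho2 : s.o2 = []) (ht : s.tmp = [])
    (hout : s.out = rows.flatten) (hQ : rows.length + raws.length ≤ Q) :
    Does (dispatch (fun i => if i = p then pinConstraint else
        edgeConstraint (if i = 0 then w else 1))) s
      { s with inp := [], o := rowOf N (ones ++ (pinned p raws).flatten)
               a := ((ls ++ unpinned p raws).map (rowOf N)).flatten.reverse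
               out := (insertAll rows ((pinned p raws).map (rowOf N))).flatten }
      (raws.length * ((w + 1) * (5 * N + 5) + 18 * N + 13 + (Q + 1) * (11 * N + 8)) + 1) := by
  induction raws generalizing s rows ls ones with
  | nil =>
    exact Does.of_eq (does_dispatch_nil _ _ h)
      (by ext1 <;> simp_all [pinned, unpinned, insertAll]) (by simp)
  | cons c raws ih =>
    obtain ⟨i, l⟩ := c
    have hi := hidx (i, l) (by simp)
    have hl := hlen (i, l) (by simp)
    have hlN := hlt (i, l) (by simp)
    simp only at hi hl hlN
    rw [List.flatMap_cons] at h
    simp only [List.length_cons] at hQ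
    replace ih := ih (fun c hc => hidx c (by simp [hc])) (fun c hc => hlen c (by simp [hc]))
      (fun c hc => hlt c (by simp [hc]))
    have hQ' := Nat.mul_le_mul_right (11 * N + 8) (by omega : rows.length + 1 ≤ Q + 1)
    by_cases hip : i = p
    · rw [if_neg (by omega)] at hl
      obtain ⟨v, rfl⟩ := List.length_eq_one_iff.1 hl
      have h1 := does_pinConstraint (rest := raws.flatMap rawCode)
        (s := { s with inp := [v].flatMap unary ++ raws.flatMap rawCode }) hN hrows
        (by simp) hz hr hr2 hz2 ho ho2 ht hout (hlN v (by simp))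
      have hlen := length_insert_le rows (rowOf N [v])
      refine Does.of_eq (does_dispatch_cons h hi (if_pos hip) h1
        (ih (ones ++ [v]) ls (rows.insert (rowOf N [v])) _
          (forall_mem_insert_length hrows (by simp)) rfl hz ha hr hr2 hz2 rfl ho2 ht rfl
          (by omega))) ?_ ?_
      · simp [pinned, unpinned, hip, insertAll]
      · simp only [List.length_cons, Nat.add_mul] at hQ' ⊢
        omega
    · have h1 := does_edgeConstraint (rest := raws.flatMap rawCode) (l := l)
        (s := { s with inp := l.flatMap unary ++ raws.flatMap rawCode }) rfl hz hr hr2 hz2 hlN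
      have hlw : l.length ≤ w + 1 := by rw [hl]; split_ifs <;> omega
      have hlw' := Nat.mul_le_mul_right (5 * N + 5) hlw
      refine Does.of_eq (does_dispatch_cons h hi ((if_neg hip).trans (by rw [hl])) h1
        (ih ones (ls ++ [l]) rows _ hrows rfl hz (by simp [ha]) hr hr2 hz2 ho ho2 ht hout
          (by omega))) ?_ ?_
      · simp [pinned, unpinned, hip]
      · simp only [List.length_cons, Nat.add_mul] at hlw' ⊢
        omega

theorem does_hypergraphProg {n w p : ℕ} (hw : 0 < w) (hp : p ≠ 0) (raws : List (ℕ × List ℕ))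
    (hidx : ∀ c ∈ raws, c.1 < 3) (hlen : ∀ c ∈ raws, c.2.length = if c.1 = 0 then w else 1)
    (hlt : ∀ c ∈ raws, ∀ v ∈ c.2, v < n) (k : ℕ) :
    ∃ s, Does (hypergraphProg w p) (initStore (rawWord n raws) k) s
        ((raws.length + w + 1) * ((w + 1) * (5 * (n + w) + 5) + 44 * (n + w) + 30 +
          2 * ((2 * raws.length + w + 2) * (11 * (n + w) + 8))) + 20 * (n + w) + 20) ∧
      s.inp = [] ∧ s.eps = List.replicate k true ∧
      (s.bad = [] ↔ ∀ l ∈ (gadget w).map (fun l => l.map (n + ·)) ++ unpinned p raws,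
        true ∈ rowOf (n + w) (l.filter fun v => v ∉ (pinned p raws).flatten)) ∧
      s.out = unary (n + w) ++ (insertAll (insertAll [] ((pinned p raws).map (rowOf (n + w))))
        (((gadget w).map (fun l => l.map (n + ·)) ++ unpinned p raws).reverse.map fun l =>
          rowOf (n + w) (l.filter fun v => v ∉ (pinned p raws).flatten))).flatten := by
  set ls := (gadget w).map (fun l => l.map (n + ·)) ++ unpinned p raws with hls
  set ones := (pinned p raws).flatten with hones
  have hN : 0 < n + w := by omega
  have hlen1 : (pinned p raws).length ≤ raws.length := by
    simpa [pinned] using List.length_filter_le _ raws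
  have hlen2 : (unpinned p raws).length ≤ raws.length := by
    simpa [unpinned] using List.length_filter_le _ raws
  have hlsl : ls.length ≤ raws.length + w + 1 := by
    simp [hls, gadget]; omega
  have hrl := length_insertAll_le [] ((pinned p raws).map (rowOf (n + w)))
  simp only [List.length_nil, List.length_map, Nat.zero_add] at hrl
  have h1 := does_readUnary_push (k := .z) (by decide) (raws.flatMap rawCode) n
    (initStore (rawWord n raws) k) rfl
  have h2 := does_gadgetCmd (w := w) (gadget w)
    { inp := raws.flatMap rawCode, eps := List.replicate k true, z := List.replicate n true } rfl
  simp only [List.length_replicate, List.append_nil] at h2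
  have h3 := does_pushList .z (List.replicate w true)
    { inp := raws.flatMap rawCode, eps := List.replicate k true, z := List.replicate n true
      a := ((gadget w).map fun l => rowOf (n + w) (l.map (n + ·))).flatten.reverse }
  have h4 := does_fill (.inr (.inl rfl))
    { inp := raws.flatMap rawCode, eps := List.replicate k true, z := List.replicate (n + w) true
      a := ((gadget w).map fun l => rowOf (n + w) (l.map (n + ·))).flatten.reverse } rfl
  have h5 := does_dispatch_hypergraph (Q := raws.length) hN hp raws hidx hlen
    (fun c hc v hv => (hlt c hc v hv).trans_le (by omega)) []
    ((gadget w).map (fun l => l.map (n + ·))) []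
    { inp := raws.flatMap rawCode, eps := List.replicate k true, z := List.replicate (n + w) true
      o := rowOf (n + w) []
      a := ((gadget w).map fun l => rowOf (n + w) (l.map (n + ·))).flatten.reverse }
    (by simp) rfl rfl (by simp [Function.comp_def]) rfl rfl rfl rfl rfl rfl rfl (by simp)
  obtain ⟨bad, hbad, h6⟩ := does_reduceRows (Q := 2 * raws.length + w + 1) (ones := ones) hN
    ls.reverse (insertAll [] ((pinned p raws).map (rowOf (n + w))))
    { eps := List.replicate k true, z := List.replicate (n + w) true
      o := rowOf (n + w) ones
      a := (ls.map (rowOf (n + w))).flatten.reverse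
      out := (insertAll [] ((pinned p raws).map (rowOf (n + w)))).flatten }
    (by
      intro R hR
      rw [mem_insertAll] at hR
      simp only [List.not_mem_nil, false_or, List.mem_map] at hR
      obtain ⟨l, -, rfl⟩ := hR
      simp)
    (by rw [List.reverse_flatten, List.map_map, List.map_reverse]; rfl)
    (by simp) rfl rfl rfl rfl rfl rfl rfl (by simp; omega)
  have h7 := does_move (k := .z) (k' := .out) (by decide) (List.replicate (n + w) true)
    { eps := List.replicate k true, z := List.replicate (n + w) true
      o := rowOf (n + w) ones, bad := bad
      out := false :: (insertAll (insertAll [] ((pinned p raws).map (rowOf (n + w))))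
        (ls.reverse.map fun l => rowOf (n + w) (l.filter fun v => v ∉ ones))).flatten } rfl
  have e3 : ({ inp := raws.flatMap rawCode, eps := List.replicate k true
               z := List.replicate n true
               a := ((gadget w).map fun l => rowOf (n + w) (l.map (n + ·))).flatten.reverse } :
      Store).set .z ((List.replicate w true).reverse ++ List.replicate n true) =
      { inp := raws.flatMap rawCode, eps := List.replicate k true
        z := List.replicate (n + w) true
        a := ((gadget w).map fun l => rowOf (n + w) (l.map (n + ·))).flatten.reverse } := by
    simp [Store.set, Nat.add_comm]
  have e4 : List.replicate (List.replicate (n + w) true).length false ++ [] =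
      rowOf (n + w) [] := by simp [rowOf_nil]
  have e1 : (initStore (rawWord n raws) k).get .z = [] := rfl
  rw [e1, List.append_nil] at h1
  refine ⟨_, Does.weaken (.seq h1 (.seq h2 (.seq (h3.of_eq e3 le_rfl)
    (.seq (h4.of_eq (congrArg (Store.set _ .o) e4) le_rfl) (.seq h5 (.seq h6 (.seq (.push _ _ _)
      h7))))))) ?_, rfl, rfl, ?_, ?_⟩
  · have a1 : (gadget w).length = w + 1 := by simp [gadget]
    simp only [List.length_reverse, List.length_replicate, a1]
    -- Products are replaced by atoms so that the remaining comparison is linear.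
    generalize hD : (2 * raws.length + w + 2) * (11 * (n + w) + 8) = D
    generalize hD' : (raws.length + 1) * (11 * (n + w) + 8) = D'
    have a3 : D' ≤ D := by
      rw [← hD, ← hD']
      exact Nat.mul_le_mul_right _ (by omega)
    generalize hE : (w + 1) * (5 * (n + w) + 5) = E
    have b1 : raws.length * (E + 18 * (n + w) + 13 + D') ≤
        (raws.length + w + 1) * (E + 18 * (n + w) + 13 + D) :=
      Nat.mul_le_mul (by omega) (by omega)
    have b2 := Nat.mul_le_mul_right (21 * (n + w) + 12 + D) hlsl
    have b3 : (w + 1) * (5 * n + w + 3) ≤ (raws.length + w + 1) * (5 * (n + w) + 5) :=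
      Nat.mul_le_mul (by omega) (by omega)
    have b4 : (raws.length + w + 1) * (E + 44 * (n + w) + 30 + 2 * D) =
        (raws.length + w + 1) * (E + 18 * (n + w) + 13 + D) +
        (raws.length + w + 1) * (21 * (n + w) + 12 + D) +
        (raws.length + w + 1) * (5 * (n + w) + 5) := by ring
    rw [b4]
    generalize (raws.length + w + 1) * (E + 18 * (n + w) + 13 + D) = F1 at *
    generalize (raws.length + w + 1) * (21 * (n + w) + 12 + D) = F2 at *
    generalize (raws.length + w + 1) * (5 * (n + w) + 5) = F3 at *
    omega
  · change bad = [] ↔ _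
    rw [hbad]
    simp
  · simp [Store.set, Store.get, unary]

/-! ### Correctness of the deletion of pinned vertices -/

/-- A scope of length one is contained in `S` exactly when its variable is in `S`, so the pin out of
`S` has the same form as a hyper-edge constraint and needs no separate treatment. -/
theorem sat_iff {d w n p : ℕ} {raws : List (ℕ × List ℕ)} (h : RawCSP d w n raws)
    (hp : p = 1 ∨ p = 2) (S : Finset ℕ) : (∀ c ∈ raws, RawSat p S c) ↔
      (∀ v ∈ (pinned p raws).flatten, v ∈ S) ∧ ∀ l ∈ unpinned p raws, ∃ v ∈ l, v ∉ S := by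
  have key : ∀ c ∈ raws, c.1 ≠ p → (RawSat p S c ↔ ∃ v ∈ c.2, v ∉ S) := by
    rintro ⟨i, l⟩ hc hip
    have hl := h.len _ hc
    simp only at hl hip
    unfold RawSat
    by_cases hi : i = 0
    · simp [hi]
    · rw [if_neg hi] at hl
      obtain ⟨v, rfl⟩ := List.length_eq_one_iff.1 hl
      simp [hi, hip]
  have key' : ∀ c : ℕ × List ℕ, c.1 = p → (RawSat p S c ↔ ∀ v ∈ c.2, v ∈ S) := by
    rintro ⟨i, l⟩ hip
    simp only at hip
    subst hip
    have : i ≠ 0 := by omega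
    simp [RawSat, this]
  simp only [pinned, unpinned, List.mem_flatten, List.mem_map, List.mem_filter,
    decide_eq_true_eq]
  constructor
  · intro hs
    constructor
    · rintro v ⟨_, ⟨c, ⟨hc, hcp⟩, rfl⟩, hv⟩
      exact (key' c hcp).1 (hs c hc) v hv
    · rintro _ ⟨c, ⟨hc, hcp⟩, rfl⟩
      exact (key c hc hcp).1 (hs c hc)
  · rintro ⟨h1, h2⟩ c hc
    by_cases hcp : c.1 = p
    · exact (key' c hcp).2 fun v hv => h1 v ⟨_, ⟨c, ⟨hc, hcp⟩, rfl⟩, hv⟩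
    · exact (key c hc hcp).2 (h2 _ ⟨c, ⟨hc, hcp⟩, rfl⟩)

theorem mem_pinned {d w n p : ℕ} {raws : List (ℕ × List ℕ)} (h : RawCSP d w n raws)
    (hp : p = 1 ∨ p = 2) {l : List ℕ} (hl : l ∈ pinned p raws) : ∃ v < n, l = [v] := by
  simp only [pinned, List.mem_map, List.mem_filter, decide_eq_true_eq] at hl
  obtain ⟨c, ⟨hc, hcp⟩, rfl⟩ := hl
  have hlen := h.len c hc
  rw [if_neg (by omega)] at hlen
  obtain ⟨v, hv⟩ := List.length_eq_one_iff.1 hlen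
  exact ⟨v, h.lt c hc v (by simp [hv]), hv⟩

theorem mem_unpinned {d w n p : ℕ} {raws : List (ℕ × List ℕ)} (h : RawCSP d w n raws)
    (hw : 1 ≤ w) {l : List ℕ} (hl : l ∈ unpinned p raws) : l.length ≤ w ∧ ∀ v ∈ l, v < n := by
  simp only [unpinned, List.mem_map, List.mem_filter] at hl
  obtain ⟨c, ⟨hc, -⟩, rfl⟩ := hl
  have hlen := h.len c hc
  exact ⟨by split_ifs at hlen <;> omega, h.lt c hc⟩

theorem lt_of_mem_flatten_pinned {d w n p : ℕ} {raws : List (ℕ × List ℕ)}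
    (h : RawCSP d w n raws) (hp : p = 1 ∨ p = 2) {v : ℕ} (hv : v ∈ (pinned p raws).flatten) :
    v < n := by
  obtain ⟨l, hl, hvl⟩ := List.mem_flatten.1 hv
  obtain ⟨u, hu, rfl⟩ := mem_pinned h hp hl
  simp only [List.mem_singleton] at hvl
  omega

theorem mem_gadget {n w : ℕ} {l : List ℕ}
    (hl : l ∈ (gadget w).map (fun l => l.map (n + ·))) :
    l = (List.range w).map (n + ·) ∨ ∃ i < w, l = [n + i] := by
  simp only [gadget, List.map_cons, List.map_map, List.mem_cons, List.mem_map, List.mem_range,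
    Function.comp] at hl
  rcases hl with rfl | ⟨i, hi, rfl⟩
  · exact .inl rfl
  · exact .inr ⟨i, hi, rfl⟩

theorem true_mem_rowOf {N : ℕ} {l : List ℕ} : true ∈ rowOf N l ↔ ∃ v < N, v ∈ l := by
  simp [true_mem_iff_getD, getD_rowOf, -List.getD_eq_getElem?_getD]

theorem count_rowOf_le (N : ℕ) (l : List ℕ) : (rowOf N l).count true ≤ l.length := by
  rw [rowOf, List.count, List.countP_map, List.countP_eq_length_filter,
    ← List.toFinset_card_of_nodup (List.nodup_range.filter _)]
  refine (Finset.card_le_card fun v hv => ?_).trans (List.toFinset_card_le l)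
  simp only [List.mem_toFinset, List.mem_filter] at hv ⊢
  simpa using hv.2

/-- Gadget vertices are never pinned, so a row without true bits comes from a scope all of whose
variables are pinned into `S`, contrary to what that constraint demands. -/
theorem rawCount_eq_zero {d w n p : ℕ} {raws : List (ℕ × List ℕ)} (h : RawCSP d w n raws)
    (hp : p = 1 ∨ p = 2) (hw : 2 ≤ w)
    (hbad : ¬ ∀ l ∈ (gadget w).map (fun l => l.map (n + ·)) ++ unpinned p raws,
      true ∈ rowOf (n + w) (l.filter fun v => v ∉ (pinned p raws).flatten)) :
    rawCount p n raws = 0 := by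
  push Not at hbad
  obtain ⟨l, hl, hbad⟩ := hbad
  rw [true_mem_rowOf] at hbad
  have hbad' : ∀ v < n + w, v ∈ l → v ∈ (pinned p raws).flatten := by
    intro v hv hvl
    by_contra hc
    exact hbad ⟨v, hv, List.mem_filter.2 ⟨hvl, by simpa using hc⟩⟩
  rcases List.mem_append.1 hl with hl | hl
  · have : ∃ i < w, n + i ∈ l := by
      rcases mem_gadget hl with rfl | ⟨i, hi, rfl⟩
      · exact ⟨0, by omega, List.mem_map.2 ⟨0, List.mem_range.2 (by omega), rfl⟩⟩
      · exact ⟨i, hi, by simp⟩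
    obtain ⟨i, hi, hil⟩ := this
    have := lt_of_mem_flatten_pinned h hp (hbad' (n + i) (by omega) hil)
    omega
  · have : IsEmpty {S : Finset ℕ // S ⊆ Finset.range n ∧ ∀ c ∈ raws, RawSat p S c} := by
      refine ⟨fun ⟨S, _, hS⟩ => ?_⟩
      rw [sat_iff h hp] at hS
      obtain ⟨v, hv, hvS⟩ := hS.2 l hl
      have := (mem_unpinned h (by omega) hl).2 v hv
      exact hvS (hS.1 v (hbad' v (by omega) hv))
    exact Nat.card_of_isEmpty

theorem mem_rows {N : ℕ} {pl ls : List (List ℕ)} {ones : List ℕ} {R : List Bool} :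
    R ∈ insertAll (insertAll [] (pl.map (rowOf N)))
      (ls.reverse.map fun l => rowOf N (l.filter fun v => v ∉ ones)) ↔
    R ∈ pl.map (rowOf N) ++ ls.map fun l => rowOf N (l.filter fun v => v ∉ ones) := by
  simp [mem_insertAll]

theorem countP_le_sum_count (v : ℕ) (L : List (List ℕ)) :
    L.countP (fun l => v ∈ l) ≤ (L.map fun l => l.count v).sum := by
  induction L with
  | nil => simp
  | cons l L ih =>
    rw [List.countP_cons, List.map_cons, List.sum_cons]
    by_cases h : v ∈ l
    · have := List.count_pos_iff.2 h
      simp only [h, decide_true, if_true]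
      omega
    · simp only [h, decide_false, Bool.false_eq_true, if_false]
      omega

theorem sum_count_pinned_add (p v : ℕ) (raws : List (ℕ × List ℕ)) :
    ((pinned p raws).map fun l => l.count v).sum + ((unpinned p raws).map fun l => l.count v).sum =
      (raws.map fun c => c.2.count v).sum := by
  induction raws with
  | nil => simp [pinned, unpinned]
  | cons c raws ih =>
    rw [List.map_cons, List.sum_cons, ← ih]
    by_cases h : c.1 = p
    · simp [pinned, unpinned, h]; omega
    · simp [pinned, unpinned, h]; omega

/-- A gadget vertex lies in the large hyper-edge and in its own singleton. -/
theorem sum_count_gadget (n w v : ℕ) :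
    (((gadget w).map fun l => l.map (n + ·)).map fun l => l.count v).sum ≤
      if n ≤ v then 2 else 0 := by
  have h1 : ∀ l : List ℕ, (l.map fun i => [n + i].count v).sum = (l.map (n + ·)).count v := by
    intro l
    induction l with
    | nil => simp
    | cons i l ih =>
      rw [List.map_cons, List.sum_cons, ih, List.map_cons, List.count_cons, List.count_cons,
        List.count_nil]
      omega
  have h2 : (((gadget w).map fun l => l.map (n + ·)).map fun l => l.count v).sum =
      ((List.range w).map (n + ·)).count v + ((List.range w).map (n + ·)).count v := by
    simp only [gadget, List.map_cons, List.map_map, List.sum_cons]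
    exact congrArg _ (h1 _)
  rw [h2]
  split_ifs with hv
  · have : ((List.range w).map (n + ·)).count v ≤ 1 :=
      List.nodup_iff_count_le_one.1 (List.nodup_range.map fun a b hab => by simpa using hab) v
    omega
  · have : ((List.range w).map (n + ·)).count v = 0 := by
      refine List.count_eq_zero.2 fun h => ?_
      obtain ⟨i, -, rfl⟩ := List.mem_map.1 h
      omega
    omega

/-- Deleting vertices (the map `φ`) and forgetting multiplicities within a scope can only lower a
degree. -/
theorem countP_getD_le {N v : ℕ} (L : List (List ℕ)) (φ : List ℕ → List ℕ)
    (hφ : ∀ l, ∀ u ∈ φ l, u ∈ l) :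
    (L.map fun l => rowOf N (φ l)).countP (fun R => R.getD v false) ≤
      (L.map fun l => l.count v).sum := by
  refine le_trans ?_ (countP_le_sum_count v L)
  rw [List.countP_map]
  refine List.countP_mono_left fun l _ hl => ?_
  simp only [Function.comp, getD_rowOf] at hl
  simpa using hφ l v hl.2

theorem rawHypergraph_rows {d w n p : ℕ} {raws : List (ℕ × List ℕ)} (h : RawCSP d w n raws)
    (hp : p = 1 ∨ p = 2) (hd : 2 ≤ d) (hw : 2 ≤ w)
    (hgood : ∀ l ∈ (gadget w).map (fun l => l.map (n + ·)) ++ unpinned p raws,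
      true ∈ rowOf (n + w) (l.filter fun v => v ∉ (pinned p raws).flatten)) :
    RawHypergraph d w (n + w) (insertAll (insertAll [] ((pinned p raws).map (rowOf (n + w))))
        (((gadget w).map (fun l => l.map (n + ·)) ++ unpinned p raws).reverse.map fun l =>
          rowOf (n + w) (l.filter fun v => v ∉ (pinned p raws).flatten))) where
  nodup := nodup_insertAll (nodup_insertAll List.nodup_nil)
  len := by
    intro R hR
    rw [mem_rows] at hR
    simp only [List.mem_append, List.mem_map] at hR
    rcases hR with ⟨l, -, rfl⟩ | ⟨l, -, rfl⟩ <;> simp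
  pos := by
    intro R hR
    rw [mem_rows, List.mem_append] at hR
    rcases hR with hR | hR
    · obtain ⟨l, hl, rfl⟩ := List.mem_map.1 hR
      obtain ⟨v, hv, rfl⟩ := mem_pinned h hp hl
      exact true_mem_rowOf.2 ⟨v, by omega, by simp⟩
    · obtain ⟨l, hl, rfl⟩ := List.mem_map.1 hR
      exact hgood l hl
  le := by
    intro R hR
    rw [mem_rows, List.mem_append] at hR
    rcases hR with hR | hR
    · obtain ⟨l, hl, rfl⟩ := List.mem_map.1 hR
      obtain ⟨v, hv, rfl⟩ := mem_pinned h hp hl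
      exact (count_rowOf_le _ _).trans (by simp; omega)
    · obtain ⟨l, hl, rfl⟩ := List.mem_map.1 hR
      refine (count_rowOf_le _ _).trans ((List.length_filter_le _ _).trans ?_)
      rcases List.mem_append.1 hl with hl | hl
      · rcases mem_gadget hl with rfl | ⟨i, hi, rfl⟩
        · simp
        · simp; omega
      · exact (mem_unpinned h (by omega) hl).1
  ex := by
    refine ⟨rowOf (n + w) ((List.range w).map (n + ·)), ?_, ?_⟩
    · rw [mem_rows, List.mem_append]
      refine .inr (List.mem_map.2 ⟨(List.range w).map (n + ·), by simp [gadget], ?_⟩)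
      -- The large gadget hyper-edge loses nothing in the deletion, since pinned vertices are below
      -- `n`; it witnesses width exactly `w`.
      rw [List.filter_eq_self.2]
      intro v hv
      obtain ⟨i, -, rfl⟩ := List.mem_map.1 hv
      have : n + i ∉ (pinned p raws).flatten := fun hc => by
        have := lt_of_mem_flatten_pinned h hp hc
        omega
      simpa using this
    · rw [← replicate_append_rowOf]
      have : rowOf w (List.range w) = List.replicate w true := by
        rw [rowOf, (List.map_eq_replicate_iff (b := true)).2 fun v hv => by simpa using hv,
          List.length_range]
      simp [this, List.count_replicate]
  deg v := by
    set rows := insertAll (insertAll [] ((pinned p raws).map (rowOf (n + w))))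
        (((gadget w).map (fun l => l.map (n + ·)) ++ unpinned p raws).reverse.map fun l =>
          rowOf (n + w) (l.filter fun v => v ∉ (pinned p raws).flatten)) with hrows
    have hnd : rows.Nodup := nodup_insertAll (nodup_insertAll List.nodup_nil)
    -- The final list has no repetitions, so merging equal rows only decreases the count.
    have h1 : rows.countP (fun R => R.getD v false) ≤
        ((pinned p raws).map (rowOf (n + w)) ++
          (((gadget w).map (fun l => l.map (n + ·)) ++ unpinned p raws).map fun l =>
          rowOf (n + w) (l.filter fun v => v ∉ (pinned p raws).flatten))).countP
            (fun R => R.getD v false) := by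
      rw [List.countP_eq_length_filter, List.countP_eq_length_filter]
      refine ((hnd.filter _).subperm fun R hR => ?_).length_le
      rw [List.mem_filter] at hR ⊢
      exact ⟨mem_rows.1 hR.1, hR.2⟩
    refine h1.trans ?_
    rw [List.map_append, List.countP_append, List.countP_append]
    have h2 : ((pinned p raws).map (rowOf (n + w))).countP (fun R => R.getD v false) ≤
        ((pinned p raws).map fun l => l.count v).sum :=
      countP_getD_le (N := n + w) (v := v) (pinned p raws) id (fun l u hu => hu)
    have h3 := countP_getD_le (N := n + w) (v := v) ((gadget w).map (fun l => l.map (n + ·)))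
      (fun l => l.filter fun v => v ∉ (pinned p raws).flatten)
      (fun l u hu => (List.mem_filter.1 hu).1)
    have h4 := countP_getD_le (N := n + w) (v := v) (unpinned p raws)
      (fun l => l.filter fun v => v ∉ (pinned p raws).flatten)
      (fun l u hu => (List.mem_filter.1 hu).1)
    have h5 := sum_count_pinned_add p v raws
    have h6 := sum_count_gadget n w v
    -- The two sources of degree do not meet: constraints contribute at most `d` below `n` and
    -- nothing from `n` on, the gadget the opposite with 2 in place of `d`.
    have h7 : (raws.map fun c => c.2.count v).sum ≤ if n ≤ v then 0 else d := by
      split_ifs with hv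
      · have : (raws.map fun c => c.2.count v) = List.replicate raws.length 0 :=
          List.map_eq_replicate_iff.2 fun c hc => List.count_eq_zero.2 fun hm => by
            have := h.lt c hc v hm
            omega
        simp [this]
      · exact h.deg v
    split_ifs at h6 h7 <;> omega

/-- Independent sets `T` avoid the gadget and the pinned vertices, satisfying sets `S` contain all
pinned vertices, and a scope escapes `S` exactly when its unpinned part escapes `T`. Thus `T ↦ T ∪
ones` and `S ↦ S \ ones` are inverse bijections. -/
theorem rowCount_rows {d w n p : ℕ} {raws : List (ℕ × List ℕ)} (h : RawCSP d w n raws)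
    (hp : p = 1 ∨ p = 2) (hw : 2 ≤ w) :
    rowCount (n + w) (insertAll (insertAll [] ((pinned p raws).map (rowOf (n + w))))
        (((gadget w).map (fun l => l.map (n + ·)) ++ unpinned p raws).reverse.map fun l =>
          rowOf (n + w) (l.filter fun v => v ∉ (pinned p raws).flatten))) =
      rawCount p n raws := by
  set ones := (pinned p raws).flatten with hones
  have hlt : ∀ v ∈ ones, v < n := fun v hv => lt_of_mem_flatten_pinned h hp hv
  have hsat : ∀ T : Finset ℕ, (T ⊆ Finset.range (n + w) ∧
      ∀ R ∈ insertAll (insertAll [] ((pinned p raws).map (rowOf (n + w))))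
        (((gadget w).map (fun l => l.map (n + ·)) ++ unpinned p raws).reverse.map fun l =>
          rowOf (n + w) (l.filter fun v => v ∉ ones)), ∃ v, R.getD v false = true ∧ v ∉ T) ↔
      T ⊆ Finset.range n ∧ (∀ v ∈ ones, v ∉ T) ∧
        ∀ l ∈ unpinned p raws, ∃ v ∈ l, v ∉ ones ∧ v ∉ T := by
    intro T
    simp only [mem_rows, List.forall_mem_append, List.forall_mem_map, getD_rowOf, List.mem_filter,
      decide_eq_true_eq, and_assoc]
    constructor
    · rintro ⟨hT, h1, h2, h3⟩
      refine ⟨fun v hv => ?_, fun v hv => ?_, fun l hl => ?_⟩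
      · have hvN := Finset.mem_range.1 (hT hv)
        by_contra hvn
        rw [Finset.mem_range, not_lt] at hvn
        obtain ⟨i, rfl⟩ := Nat.exists_eq_add_of_le hvn
        -- The singleton hyper-edge of the gadget vertex `n + i` excludes it from `T`.
        have h4 := h2 [i] (by simp [gadget]; omega)
        simp only [List.map_cons, List.map_nil, List.mem_singleton] at h4
        obtain ⟨_, -, rfl, -, hc⟩ := h4
        exact hc hv
      · obtain ⟨l, hl, hvl⟩ := List.mem_flatten.1 hv
        obtain ⟨u, hu, rfl⟩ := mem_pinned h hp hl
        obtain ⟨x, -, hx, hxT⟩ := h1 _ hl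
        simp only [List.mem_singleton] at hx hvl
        rwa [hvl, ← hx]
      · obtain ⟨v, -, hv⟩ := h3 l hl
        exact ⟨v, hv⟩
    · rintro ⟨hT, h1, h2⟩
      have hge : ∀ v, n ≤ v → v ∉ ones ∧ v ∉ T := fun v hv =>
        ⟨fun hc => by have := hlt v hc; omega,
          fun hc => by have := Finset.mem_range.1 (hT hc); omega⟩
      refine ⟨fun v hv => ?_, fun l hl => ?_, fun l hl => ?_, fun l hl => ?_⟩
      · have := Finset.mem_range.1 (hT hv)
        exact Finset.mem_range.2 (by omega)
      · obtain ⟨v, hv, rfl⟩ := mem_pinned h hp hl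
        exact ⟨v, by omega, by simp, h1 v (List.mem_flatten.2 ⟨_, hl, by simp⟩)⟩
      · rcases mem_gadget (n := n) (List.mem_map_of_mem hl) with hl' | ⟨i, hi, hl'⟩
        · rw [hl']
          -- Conversely the large gadget hyper-edge escapes `T` already at its first vertex `n`.
          exact ⟨n, by omega, List.mem_map.2 ⟨0, List.mem_range.2 (by omega), rfl⟩, hge n le_rfl⟩
        · rw [hl']
          exact ⟨n + i, by omega, by simp, hge _ (by omega)⟩
      · obtain ⟨v, hv, hv'⟩ := h2 l hl
        have := (mem_unpinned h (by omega) hl).2 v hv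
        exact ⟨v, by omega, hv, hv'⟩
  simp only [rowCount, rawCount, hsat, sat_iff h hp]
  refine Nat.card_congr
    { toFun := fun T => ⟨T.1 ∪ ones.toFinset, fun v hv => ?_, fun v hv => ?_, fun l hl => ?_⟩
      invFun := fun S => ⟨S.1 \ ones.toFinset, fun v hv => ?_, fun v hv => ?_, fun l hl => ?_⟩
      left_inv := fun T => ?_
      right_inv := fun S => ?_ }
  · simp only [Finset.mem_union, List.mem_toFinset] at hv
    rcases hv with hv | hv
    · exact T.2.1 hv
    · exact Finset.mem_range.2 (hlt v hv)
  · exact Finset.mem_union_right _ (List.mem_toFinset.2 hv)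
  · obtain ⟨v, hv, h1, h2⟩ := T.2.2.2 l hl
    exact ⟨v, hv, by simp only [Finset.mem_union, List.mem_toFinset]; tauto⟩
  · exact S.2.1 (Finset.mem_sdiff.1 hv).1
  · simp only [Finset.mem_sdiff, List.mem_toFinset]
    tauto
  · obtain ⟨v, hv, h1⟩ := S.2.2.2 l hl
    exact ⟨v, hv, fun hc => h1 (S.2.2.1 v hc), fun hc => h1 (Finset.mem_sdiff.1 hc).1⟩
  · ext v
    simp only [Finset.mem_sdiff, Finset.mem_union, List.mem_toFinset]
    have := T.2.2.1 v
    tauto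
  · ext v
    simp only [Finset.mem_sdiff, Finset.mem_union, List.mem_toFinset]
    have := S.2.2.1 v
    tauto

/-- Since both factors are at least 2, `X + W ≤ X * W`; hence every linear quantity is at most a
multiple of `Y = X * W`, and the whole bound is cubic in `Y`. -/
theorem hypergraphProg_time {X w r n : ℕ} (hX : 2 ≤ X) (hw : 2 ≤ w) (hn : n ≤ X) (hr : r ≤ X) :
    (r + w + 1) * ((w + 1) * (5 * (n + w) + 5) + 44 * (n + w) + 30 +
      2 * ((2 * r + w + 2) * (11 * (n + w) + 8))) + 20 * (n + w) + 20 ≤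
      300 * (w + 1) ^ 3 * X ^ 3 := by
  obtain ⟨W, hW⟩ : ∃ W, W = w + 1 := ⟨_, rfl⟩
  have h1 : X + W ≤ X * W := by nlinarith
  have h2 : 300 * (w + 1) ^ 3 * X ^ 3 = 300 * (X * W) ^ 3 := by rw [hW]; ring
  have h3 : 6 ≤ X * W := Nat.mul_le_mul hX (by omega : 3 ≤ W)
  have h4 : W ≤ X * W := Nat.le_mul_of_pos_left _ (by omega)
  rw [h2]
  generalize X * W = Y at *
  have a1 : (w + 1) * (5 * (n + w) + 5) ≤ Y * (10 * Y) := Nat.mul_le_mul (by omega) (by omega)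
  have a2 : (2 * r + w + 2) * (11 * (n + w) + 8) ≤ (3 * Y) * (19 * Y) :=
    Nat.mul_le_mul (by omega) (by omega)
  have a3 : Y * Y = Y ^ 2 := by ring
  have a4 : Y ≤ Y ^ 2 := Nat.le_self_pow (by norm_num) _
  have a5 : (w + 1) * (5 * (n + w) + 5) + 44 * (n + w) + 30 +
      2 * ((2 * r + w + 2) * (11 * (n + w) + 8)) ≤ 260 * Y ^ 2 := by nlinarith
  have a6 := Nat.mul_le_mul (by omega : r + w + 1 ≤ Y) a5
  have a7 : Y ≤ Y ^ 3 := Nat.le_self_pow (by norm_num) _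
  have a8 : Y * (260 * Y ^ 2) = 260 * Y ^ 3 := by ring
  omega

theorem length_le_flatMap_rawCode (raws : List (ℕ × List ℕ)) :
    raws.length ≤ (raws.flatMap rawCode).length := by
  induction raws with
  | nil => simp
  | cons c raws ih =>
    simp only [List.flatMap_cons, List.length_append, List.length_cons, rawCode, length_unary]
    omega

theorem apReducible_countCSP_countHIS (β : Bool) {d w : ℕ} (hd : 2 ≤ d) (hw : 2 ≤ w) :
    APReducible (countCSP d (lang β w)) (countHIS w d) := by
  have hp : pinIdx β = 1 ∨ pinIdx β = 2 := by cases β <;> simp [pinIdx]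
  refine apReducible_of_does (hypergraphProg w (pinIdx β)) (300 * (w + 1) ^ 3) 1
    fun I x hx k => ?_
  obtain ⟨n, raws, h, rfl, hcount⟩ := exists_raw_of_encodes hx
  obtain ⟨s, hs, h1, h2, h3, h4⟩ := does_hypergraphProg (w := w) (p := pinIdx β) (by omega)
    (by omega) raws h.idx h.len h.lt k
  have hX : n + raws.length + 2 ≤ (rawWord n raws).length + 1 := by
    have := length_le_flatMap_rawCode raws
    simp only [rawWord, List.length_append, length_unary]
    omega
  refine ⟨s, hs.weaken (hypergraphProg_time (by omega) hw (by omega) (by omega)), h1, ?_⟩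
  by_cases hb : s.bad = []
  · obtain ⟨J, hJ, hJc⟩ := exists_encodes_of_rows (rawHypergraph_rows h hp hd hw (h3.1 hb))
    exact .inr ⟨hb, by simp [h2], J, h4 ▸ hJ, by rw [hJc, hcount, rowCount_rows h hp hw]⟩
  · exact .inl ⟨hb, by rw [hcount, rawCount_eq_zero h hp hw (mt h3.2 hb)]⟩

end ApproxCount

/-- The six reductions are given directly, so no composition of AP-reductions is used. The languages
with OR and NAND are, by definition, `lang false w` and `lang true w`. -/
theorem mainTheorem6 (d w : ℕ) (hd : 2 ≤ d) (hw : 2 ≤ w) :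
    ApproxCount.APInterreducible (ApproxCount.countHIS w d)
        (ApproxCount.countCSP d ([ApproxCount.orRel w] ++ ApproxCount.pins)) ∧
      ApproxCount.APInterreducible
        (ApproxCount.countCSP d ([ApproxCount.orRel w] ++ ApproxCount.pins))
        (ApproxCount.countCSP d ([ApproxCount.nandRel w] ++ ApproxCount.pins)) ∧
      ApproxCount.APInterreducible (ApproxCount.countHIS w d)
        (ApproxCount.countCSP d ([ApproxCount.nandRel w] ++ ApproxCount.pins)) :=
  ⟨⟨ApproxCount.apReducible_countHIS_countCSP false hd hw,
      ApproxCount.apReducible_countCSP_countHIS false hd hw⟩,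
    ⟨ApproxCount.apReducible_flip false d w, ApproxCount.apReducible_flip true d w⟩,
    ⟨ApproxCount.apReducible_countHIS_countCSP true hd hw,
      ApproxCount.apReducible_countCSP_countHIS true hd hw⟩⟩
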